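/- **Theorem 1.** Let $k \ge 2$ be a fixed integer. For a finite set $P$ of $n \ge k$ points in the Euclidean plane, the $k$-dispersion problem asks for a $k$-element subset $K \subseteq P$ whose minimum pairwise distance is as large as possible among all $k$-element subsets of $P$. There is a combinatorial algorithm that, given any set $P$ of $n \ge k$ points in the plane, solves the $k$-dispersion problem for $P$ exactly in $O(n^{k-1}\log n)$ time in the worst case, where the constant in the $O$-notation depends only on $k$. Here an algorithm is a program for a random access machine that has natural-number variables and arrays and the operations addition, truncated subtraction and comparison on natural numbers; each elementary operation, memory access, comparison and control decision takes one unit of time. "Combinatorial" means that the machine uses the points only through their indices and through exact real comparisons of two polynomial expressions with integer constants, fixed by the program, in the coordinates of points addressed by index; real numbers are neither stored nor rounded to integers. The input is $n$ together with $n$ distinct points $p_0,\dots,p_{n-1}$, and the output is the list of the indices of the points of an optimal $k$-element subset. -/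

import Mathlib

/-! ### The dispersion problem -/

/-- `K` is an optimal solution of the `k`-dispersion problem for the finite set `P`: a subset of
`P` with exactly `k` points whose minimum pairwise distance is largest among all `k`-point
subsets of `P`. For a finite set with at least two points, `Set.infsep` is the minimum distance
between two distinct points. -/
def IsOptimalDispersion {α : Type*} [MetricSpace α] (P : Finset α) (k : ℕ) (K : Finset α) : Prop :=
  K ⊆ P ∧ K.card = k ∧
    ∀ L : Finset α, L ⊆ P → L.card = k → (L : Set α).infsep ≤ (K : Set α).infsep

/-! ### The machine model

A random access machine for planar point sets. Its memory consists of natural-number variables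
and natural-number arrays (random access, unbounded length). The arithmetic on natural numbers is
addition and truncated subtraction. The points are read-only and are addressed by their indices.
Real numbers occur only in tests, which compare two fixed polynomial expressions in coordinates
of points exactly. Real numbers can be neither stored nor rounded to integers. Every operation, memory access,
comparison and control decision costs one unit of time. -/

/-- The plane. -/
abbrev Plane : Type := EuclideanSpace ℝ (Fin 2)

/-- Natural-number expressions. -/
inductive NatExpr : Type
  | const (c : ℕ)
  | var (x : ℕ)
  | get (a : ℕ) (i : NatExpr)
  | add (e f : NatExpr)
  | sub (e f : NatExpr)

/-- Real-number expressions; `coord c i` is coordinate `c` of the point with index `i`. -/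
inductive RealExpr : Type
  | const (c : ℤ)
  | coord (c : Fin 2) (i : NatExpr)
  | add (e f : RealExpr)
  | sub (e f : RealExpr)
  | mul (e f : RealExpr)

/-- Tests. -/
inductive Test : Type
  | natEq (e f : NatExpr)
  | natLt (e f : NatExpr)
  | realLt (e f : RealExpr)
  | neg (b : Test)
  | conj (b d : Test)

/-- Programs. -/
inductive Prog : Type
  | skip
  /-- assign to a variable -/
  | set (x : ℕ) (e : NatExpr)
  /-- write the value of `e` into cell `i` of array `a` -/
  | put (a : ℕ) (i e : NatExpr)
  | seq (p q : Prog)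
  | cond (b : Test) (p q : Prog)
  /-- repeat `p` as long as the test `b` holds -/
  | loop (b : Test) (p : Prog)

/-- The contents of the memory. -/
structure Store : Type where
  /-- the variables -/
  var : ℕ → ℕ
  /-- the arrays -/
  arr : ℕ → ℕ → ℕ

/-- The value of a natural-number expression. -/
def NatExpr.eval (s : Store) : NatExpr → ℕ
  | .const c => c
  | .var x => s.var x
  | .get a i => s.arr a (i.eval s)
  | .add e f => e.eval s + f.eval s
  | .sub e f => e.eval s - f.eval s

/-- The time to evaluate a natural-number expression. -/
def NatExpr.cost : NatExpr → ℕ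
  | .const _ => 1
  | .var _ => 1
  | .get _ i => 1 + i.cost
  | .add e f => 1 + e.cost + f.cost
  | .sub e f => 1 + e.cost + f.cost

/-- The value of a real-number expression over the points `pt 0, pt 1, …`. -/
noncomputable def RealExpr.eval (pt : ℕ → Plane) (s : Store) : RealExpr → ℝ
  | .const c => (c : ℝ)
  | .coord c i => pt (i.eval s) c
  | .add e f => e.eval pt s + f.eval pt s
  | .sub e f => e.eval pt s - f.eval pt s
  | .mul e f => e.eval pt s * f.eval pt s

/-- The time to evaluate a real-number expression. -/
def RealExpr.cost : RealExpr → ℕ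
  | .const _ => 1
  | .coord _ i => 1 + i.cost
  | .add e f => 1 + e.cost + f.cost
  | .sub e f => 1 + e.cost + f.cost
  | .mul e f => 1 + e.cost + f.cost

/-- The outcome of a test. -/
def Test.Holds (pt : ℕ → Plane) (s : Store) : Test → Prop
  | .natEq e f => e.eval s = f.eval s
  | .natLt e f => e.eval s < f.eval s
  | .realLt e f => e.eval pt s < f.eval pt s
  | .neg b => ¬ b.Holds pt s
  | .conj b d => b.Holds pt s ∧ d.Holds pt s

/-- The time to evaluate a test. -/
def Test.cost : Test → ℕ
  | .natEq e f => 1 + e.cost + f.cost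
  | .natLt e f => 1 + e.cost + f.cost
  | .realLt e f => 1 + e.cost + f.cost
  | .neg b => 1 + b.cost
  | .conj b d => 1 + b.cost + d.cost

/-- The memory after an assignment to variable `x`. -/
def Store.set (s : Store) (x v : ℕ) : Store :=
  { s with var := Function.update s.var x v }

/-- The memory after an assignment to cell `i` of array `a`. -/
def Store.put (s : Store) (a i v : ℕ) : Store :=
  { s with arr := Function.update s.arr a (Function.update (s.arr a) i v) }

/-- `Exec pt p s t s'`: on the points `pt`, the program `p`, started with memory `s`, halts after
exactly `t` units of time with memory `s'`. For each program and memory exactly one rule applies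
at a time, so that `t` and `s'` are determined by `pt`, `p` and `s`. -/
inductive Exec (pt : ℕ → Plane) : Prog → Store → ℕ → Store → Prop
  | skip (s : Store) : Exec pt .skip s 1 s
  | set (x : ℕ) (e : NatExpr) (s : Store) :
      Exec pt (.set x e) s (1 + e.cost) (s.set x (e.eval s))
  | put (a : ℕ) (i e : NatExpr) (s : Store) :
      Exec pt (.put a i e) s (1 + i.cost + e.cost) (s.put a (i.eval s) (e.eval s))
  | seq {p q : Prog} {s s₁ s₂ : Store} {t₁ t₂ : ℕ} :
      Exec pt p s t₁ s₁ → Exec pt q s₁ t₂ s₂ → Exec pt (.seq p q) s (t₁ + t₂) s₂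
  | condTrue {b : Test} {p q : Prog} {s s₁ : Store} {t : ℕ} :
      b.Holds pt s → Exec pt p s t s₁ → Exec pt (.cond b p q) s (1 + b.cost + t) s₁
  | condFalse {b : Test} {p q : Prog} {s s₁ : Store} {t : ℕ} :
      ¬ b.Holds pt s → Exec pt q s t s₁ → Exec pt (.cond b p q) s (1 + b.cost + t) s₁
  | loopFalse {b : Test} {p : Prog} {s : Store} :
      ¬ b.Holds pt s → Exec pt (.loop b p) s (1 + b.cost) s
  | loopTrue {b : Test} {p : Prog} {s s₁ s₂ : Store} {t₁ t₂ : ℕ} :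
      b.Holds pt s → Exec pt p s t₁ s₁ → Exec pt (.loop b p) s₁ t₂ s₂ →
        Exec pt (.loop b p) s (1 + b.cost + t₁ + t₂) s₂

/-- The initial memory: variable `0` holds the number of points, everything else is `0`. -/
def Store.init (n : ℕ) : Store where
  var := fun x => if x = 0 then n else 0
  arr := fun _ _ => 0

/-- The input points as the machine addresses them; out-of-range indices yield the origin. -/
noncomputable def inputPoints {n : ℕ} (p : Fin n ↪ Plane) : ℕ → Plane :=
  fun i => if h : i < n then p ⟨i, h⟩ else 0

/-- The memory `s` describes an optimal solution of the `k`-dispersion problem for the point set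
`{p 0, …, p (n - 1)}`: the first `k` cells of array `0` contain the indices of the `k` distinct
points of an optimal `k`-point subset. -/
def IsDispersionOutput {n : ℕ} (p : Fin n ↪ Plane) (k : ℕ) (s : Store) : Prop :=
  ∃ q : Fin k ↪ Fin n, (∀ j : Fin k, s.arr 0 (j : ℕ) = (q j : ℕ)) ∧
    IsOptimalDispersion (Finset.univ.map p) k (Finset.univ.map (q.trans p))

/-! ### Program logic: frames, loop-free programs, and bounded runs -/

attribute [simp] NatExpr.eval RealExpr.eval Test.Holds

@[simp] theorem Store.set_var (s : Store) (x v y : ℕ) :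
    (s.set x v).var y = if y = x then v else s.var y := by
  simp [Store.set, Function.update_apply]

@[simp] theorem Store.set_arr (s : Store) (x v : ℕ) : (s.set x v).arr = s.arr := rfl

@[simp] theorem Store.put_var (s : Store) (a i v : ℕ) : (s.put a i v).var = s.var := rfl

@[simp] theorem Store.put_arr (s : Store) (a i v b : ℕ) :
    (s.put a i v).arr b = if b = a then Function.update (s.arr a) i v else s.arr b := by
  simp [Store.put, Function.update_apply]

/-- `p` contains no assignment to the variable `x`. -/
@[simp] def Prog.KeepsVar (x : ℕ) : Prog → Prop
  | .skip => True
  | .set y _ => x ≠ y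
  | .put _ _ _ => True
  | .seq p q => p.KeepsVar x ∧ q.KeepsVar x
  | .cond _ p q => p.KeepsVar x ∧ q.KeepsVar x
  | .loop _ p => p.KeepsVar x

/-- `p` contains no assignment to a cell of the array `a`. -/
@[simp] def Prog.KeepsArr (a : ℕ) : Prog → Prop
  | .skip => True
  | .set _ _ => True
  | .put b _ _ => a ≠ b
  | .seq p q => p.KeepsArr a ∧ q.KeepsArr a
  | .cond _ p q => p.KeepsArr a ∧ q.KeepsArr a
  | .loop _ p => p.KeepsArr a

theorem Exec.var_eq {pt : ℕ → Plane} {p : Prog} {s s' : Store} {t x : ℕ}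
    (h : Exec pt p s t s') (hx : p.KeepsVar x) : s'.var x = s.var x := by
  induction h with
  | skip s => rfl
  | set y e s => simp_all
  | put a i e s => rfl
  | seq _ _ ih₁ ih₂ => rw [ih₂ hx.2, ih₁ hx.1]
  | condTrue _ _ ih => exact ih hx.1
  | condFalse _ _ ih => exact ih hx.2
  | loopFalse _ => rfl
  | loopTrue _ _ _ ih₁ ih₂ => rw [ih₂ hx, ih₁ hx]

theorem Exec.arr_eq {pt : ℕ → Plane} {p : Prog} {s s' : Store} {t a : ℕ}
    (h : Exec pt p s t s') (ha : p.KeepsArr a) : s'.arr a = s.arr a := by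
  induction h with
  | skip s => rfl
  | set y e s => rfl
  | put b i e s => simp_all
  | seq _ _ ih₁ ih₂ => rw [ih₂ ha.2, ih₁ ha.1]
  | condTrue _ _ ih => exact ih ha.1
  | condFalse _ _ ih => exact ih ha.2
  | loopFalse _ => rfl
  | loopTrue _ _ _ ih₁ ih₂ => rw [ih₂ ha, ih₁ ha]

/-- `p` contains no loop. -/
@[simp] def Prog.LoopFree : Prog → Prop
  | .skip => True
  | .set _ _ => True
  | .put _ _ _ => True
  | .seq p q => p.LoopFree ∧ q.LoopFree
  | .cond _ p q => p.LoopFree ∧ q.LoopFree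
  | .loop _ _ => False

open Classical in
/-- The final memory of a loop-free program. -/
@[simp] noncomputable def Prog.run (pt : ℕ → Plane) : Prog → Store → Store
  | .skip, s => s
  | .set x e, s => s.set x (e.eval s)
  | .put a i e, s => s.put a (i.eval s) (e.eval s)
  | .seq p q, s => q.run pt (p.run pt s)
  | .cond b p q, s => if b.Holds pt s then p.run pt s else q.run pt s
  | .loop _ _, s => s

theorem Prog.run_cond_pos {pt : ℕ → Plane} {b : Test} {p q : Prog} {s : Store}
    (h : b.Holds pt s) : (Prog.cond b p q).run pt s = p.run pt s := if_pos h

theorem Prog.run_cond_neg {pt : ℕ → Plane} {b : Test} {p q : Prog} {s : Store}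
    (h : ¬ b.Holds pt s) : (Prog.cond b p q).run pt s = q.run pt s := if_neg h

/-- An upper bound on the running time of a loop-free program. -/
def Prog.flatCost : Prog → ℕ
  | .skip => 1
  | .set _ e => 1 + e.cost
  | .put _ i e => 1 + i.cost + e.cost
  | .seq p q => p.flatCost + q.flatCost
  | .cond b p q => 1 + b.cost + (p.flatCost + q.flatCost)
  | .loop _ _ => 0

theorem Prog.LoopFree.exec (pt : ℕ → Plane) {p : Prog} (hp : p.LoopFree) (s : Store) :
    ∃ t, t ≤ p.flatCost ∧ Exec pt p s t (p.run pt s) := by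
  induction p generalizing s with
  | skip => exact ⟨1, le_rfl, .skip s⟩
  | set x e => exact ⟨_, le_rfl, .set x e s⟩
  | put a i e => exact ⟨_, le_rfl, .put a i e s⟩
  | seq p q ihp ihq =>
    obtain ⟨t₁, h₁, e₁⟩ := ihp hp.1 s
    obtain ⟨t₂, h₂, e₂⟩ := ihq hp.2 (p.run pt s)
    exact ⟨t₁ + t₂, Nat.add_le_add h₁ h₂, .seq e₁ e₂⟩
  | cond b p q ihp ihq =>
    by_cases hb : b.Holds pt s
    · obtain ⟨t₁, h₁, e₁⟩ := ihp hp.1 s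
      refine ⟨1 + b.cost + t₁, by simp only [Prog.flatCost]; omega, ?_⟩
      simp only [Prog.run, hb, if_true]
      exact .condTrue hb e₁
    · obtain ⟨t₁, h₁, e₁⟩ := ihq hp.2 s
      refine ⟨1 + b.cost + t₁, by simp only [Prog.flatCost]; omega, ?_⟩
      simp only [Prog.run, hb, if_false]
      exact .condFalse hb e₁
  | loop b p => exact hp.elim

theorem Prog.LoopFree.run_var {pt : ℕ → Plane} {p : Prog} (hp : p.LoopFree) {s : Store} {x : ℕ}
    (hx : p.KeepsVar x) : (p.run pt s).var x = s.var x := by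
  obtain ⟨_, -, h⟩ := hp.exec pt s
  exact h.var_eq hx

/-- Started with memory `s`, the program `p` halts within `T` units of time with a memory that
satisfies `Q`. -/
def Runs (pt : ℕ → Plane) (p : Prog) (s : Store) (T : ℕ) (Q : Store → Prop) : Prop :=
  ∃ t s', Exec pt p s t s' ∧ t ≤ T ∧ Q s'

namespace Runs

variable {pt : ℕ → Plane} {p q : Prog} {b : Test} {s : Store} {T T' : ℕ} {Q Q' : Store → Prop}

theorem mono (h : Runs pt p s T Q) (hT : T ≤ T') (hQ : ∀ s', Q s' → Q' s') :
    Runs pt p s T' Q' := by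
  obtain ⟨t, s', e, ht, hq⟩ := h
  exact ⟨t, s', e, ht.trans hT, hQ _ hq⟩

theorem frame (h : Runs pt p s T Q) :
    Runs pt p s T fun s' => Q s' ∧ (∀ x, p.KeepsVar x → s'.var x = s.var x) ∧
      ∀ a, p.KeepsArr a → s'.arr a = s.arr a := by
  obtain ⟨t, s', e, ht, hq⟩ := h
  exact ⟨t, s', e, ht, hq, fun x hx => e.var_eq hx, fun a ha => e.arr_eq ha⟩

theorem seq (h : Runs pt p s T fun s₁ => Runs pt q s₁ T' Q) :
    Runs pt (.seq p q) s (T + T') Q := by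
  obtain ⟨t, s₁, e, ht, t', s', e', ht', hq⟩ := h
  exact ⟨t + t', s', .seq e e', Nat.add_le_add ht ht', hq⟩

theorem of_loopFree (hp : p.LoopFree) (hQ : Q (p.run pt s)) : Runs pt p s p.flatCost Q := by
  obtain ⟨t, ht, e⟩ := hp.exec pt s
  exact ⟨t, _, e, ht, hQ⟩

theorem seq_loopFree (hp : p.LoopFree) (h : Runs pt q (p.run pt s) T Q) :
    Runs pt (.seq p q) s (p.flatCost + T) Q :=
  seq (of_loopFree hp h)

/-- The loop rule with an amortized time bound. -/
theorem loop_potential {Inv : ℕ → Store → Prop}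
    (step : ∀ Φ s, Inv Φ s → b.Holds pt s → ∃ T, Runs pt p s T fun s' =>
      ∃ Φ', 1 + b.cost + T + Φ' ≤ Φ ∧ Inv Φ' s') (Φ : ℕ) (s : Store) (h : Inv Φ s) :
    Runs pt (.loop b p) s (Φ + (1 + b.cost))
      fun s' => (∃ Φ', Inv Φ' s') ∧ ¬ b.Holds pt s' := by
  induction Φ using Nat.strong_induction_on generalizing s with
  | _ Φ ih =>
    by_cases hb : b.Holds pt s
    · obtain ⟨T, t, s₁, e, ht, Φ', hΦ, hI⟩ := step Φ s h hb
      obtain ⟨t', s', e', ht', hq⟩ := ih Φ' (by omega) s₁ hI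
      exact ⟨_, s', .loopTrue hb e e', by omega, hq⟩
    · exact ⟨_, s, .loopFalse hb, by omega, ⟨Φ, h⟩, hb⟩

/-- The loop rule with a bound on the number of rounds. -/
theorem loop_fuel {Inv : ℕ → Store → Prop}
    (step : ∀ m s, Inv m s → b.Holds pt s → Runs pt p s T fun s' => ∃ m', m' < m ∧ Inv m' s')
    (m : ℕ) (s : Store) (h : Inv m s) :
    Runs pt (.loop b p) s (m * (1 + b.cost + T) + (1 + b.cost))
      fun s' => (∃ m', Inv m' s') ∧ ¬ b.Holds pt s' := by
  refine (loop_potential (Inv := fun Φ s => ∃ m, m * (1 + b.cost + T) ≤ Φ ∧ Inv m s) ?_ _ s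
    ⟨m, le_rfl, h⟩).mono le_rfl ?_
  · rintro Φ s ⟨m, hm, hI⟩ hb
    refine ⟨T, (step m s hI hb).mono le_rfl ?_⟩
    rintro s' ⟨m', hlt, hI'⟩
    refine ⟨m' * (1 + b.cost + T), ?_, m', le_rfl, hI'⟩
    have : (m' + 1) * (1 + b.cost + T) ≤ m * (1 + b.cost + T) := Nat.mul_le_mul_right _ hlt
    rw [Nat.succ_mul] at this
    omega
  · rintro s' ⟨⟨_, m, _, hI⟩, hb⟩
    exact ⟨⟨m, hI⟩, hb⟩

end Runs

/-! ### Merge sort -/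

section MergeSort

variable {κ : Type*} [LinearOrder κ]

/-- A two-way merge in progress: `B` on `[lo, t)` holds the elements of `A` on `[lo, i)` and
`[mid, j)` in increasing order. -/
structure MergeState (key : ℕ → κ) (A B : ℕ → ℕ) (lo mid hi i j t : ℕ) : Prop where
  lo_le : lo ≤ i
  le_mid : i ≤ mid
  mid_le : mid ≤ j
  le_hi : j ≤ hi
  count : t + mid = i + j
  sorted : ∀ y₁ y₂, lo ≤ y₁ → y₁ < y₂ → y₂ < t → key (B y₁) ≤ key (B y₂)
  le_left : ∀ y x, lo ≤ y → y < t → i ≤ x → x < mid → key (B y) ≤ key (A x)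
  le_right : ∀ y x, lo ≤ y → y < t → j ≤ x → x < hi → key (B y) ≤ key (A x)
  source : ∀ y, lo ≤ y → y < t → ∃ x, lo ≤ x ∧ x < hi ∧ B y = A x
  target : ∀ x, lo ≤ x → x < hi →
    (∃ y, lo ≤ y ∧ y < t ∧ B y = A x) ∨ (i ≤ x ∧ x < mid) ∨ (j ≤ x ∧ x < hi)

theorem MergeState.push {key : ℕ → κ} {A B : ℕ → ℕ} {lo mid hi i j t : ℕ}
    (h : MergeState key A B lo mid hi i j t) {e i' j' : ℕ} (he : lo ≤ e) (he' : e < hi)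
    (hil : i ≤ i') (hil' : i' ≤ mid) (hj : j ≤ j') (hj' : j' ≤ hi) (hc : i' + j' = i + j + 1)
    (hB : ∀ y, lo ≤ y → y < t → key (B y) ≤ key (A e))
    (hl : ∀ x, i' ≤ x → x < mid → key (A e) ≤ key (A x))
    (hr : ∀ x, j' ≤ x → x < hi → key (A e) ≤ key (A x))
    (hie : ∀ x, i ≤ x → x < mid → x = e ∨ i' ≤ x)
    (hje : ∀ x, j ≤ x → x < hi → x = e ∨ j' ≤ x) :
    MergeState key A (Function.update B t (A e)) lo mid hi i' j' (t + 1) where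
  lo_le := h.lo_le.trans hil
  le_mid := hil'
  mid_le := h.mid_le.trans hj
  le_hi := hj'
  count := by have := h.count; omega
  sorted y₁ y₂ h₁ h₂ h₃ := by
    rcases Nat.lt_succ_iff_lt_or_eq.1 h₃ with h₄ | rfl
    · rw [Function.update_of_ne (by omega), Function.update_of_ne (by omega)]
      exact h.sorted _ _ h₁ h₂ h₄
    · rw [Function.update_of_ne (by omega), Function.update_self]
      exact hB _ h₁ h₂
  le_left y x h₁ h₂ h₃ h₄ := by
    rcases Nat.lt_succ_iff_lt_or_eq.1 h₂ with h₅ | rfl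
    · rw [Function.update_of_ne (by omega)]
      exact h.le_left _ _ h₁ h₅ (hil.trans h₃) h₄
    · rw [Function.update_self]
      exact hl _ h₃ h₄
  le_right y x h₁ h₂ h₃ h₄ := by
    rcases Nat.lt_succ_iff_lt_or_eq.1 h₂ with h₅ | rfl
    · rw [Function.update_of_ne (by omega)]
      exact h.le_right _ _ h₁ h₅ (hj.trans h₃) h₄
    · rw [Function.update_self]
      exact hr _ h₃ h₄
  source y h₁ h₂ := by
    rcases Nat.lt_succ_iff_lt_or_eq.1 h₂ with h₅ | rfl
    · rw [Function.update_of_ne (by omega)]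
      exact h.source _ h₁ h₅
    · exact ⟨e, he, he', Function.update_self ..⟩
  target x h₁ h₂ := by
    have hlo : lo ≤ t := by
      have := h.count; have := h.lo_le; have := h.mid_le; omega
    have new : ∃ y, lo ≤ y ∧ y < t + 1 ∧ Function.update B t (A e) y = A e :=
      ⟨t, hlo, by omega, Function.update_self ..⟩
    rcases h.target x h₁ h₂ with ⟨y, h₃, h₄, h₅⟩ | ⟨h₃, h₄⟩ | ⟨h₃, h₄⟩
    · exact .inl ⟨y, h₃, by omega, by rw [Function.update_of_ne (by omega), h₅]⟩
    · rcases hie x h₃ h₄ with rfl | h₅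
      · exact .inl new
      · exact .inr (.inl ⟨h₅, h₄⟩)
    · rcases hje x h₃ h₄ with rfl | h₅
      · exact .inl new
      · exact .inr (.inr ⟨h₅, h₄⟩)

/-- One step of a merge of array `a` into array `4`. -/
def mergeStep (T : NatExpr → NatExpr → Test) (a : ℕ) : Prog :=
  .seq
    (.cond (.conj (.natLt (.var 5) (.var 3))
        (.neg (.conj (.natLt (.var 6) (.var 4)) (T (.get a (.var 6)) (.get a (.var 5))))))
      (.seq (.put 4 (.var 7) (.get a (.var 5))) (.set 5 (.add (.var 5) (.const 1))))
      (.seq (.put 4 (.var 7) (.get a (.var 6))) (.set 6 (.add (.var 6) (.const 1)))))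
    (.set 7 (.add (.var 7) (.const 1)))

def mergeRuns (T : NatExpr → NatExpr → Test) (a : ℕ) : Prog :=
  .loop (.natLt (.var 7) (.var 4)) (mergeStep T a)

/-- The tests `T e f` compare the keys of `e` and `f` as long as the variables from `30` on
have the values `σ`. -/
def Compares (pt : ℕ → Plane) (T : NatExpr → NatExpr → Test) (σ : ℕ → ℕ) (key : ℕ → κ) : Prop :=
  ∀ s : Store, (∀ x, 30 ≤ x → s.var x = σ x) → ∀ e f : NatExpr,
    (T e f).Holds pt s ↔ key (e.eval s) < key (f.eval s)

variable {pt : ℕ → Plane} {T : NatExpr → NatExpr → Test} {σ : ℕ → ℕ} {key : ℕ → κ}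

def mergeConst (T : NatExpr → NatExpr → Test) (a : ℕ) : ℕ :=
  1 + (Test.natLt (.var 7) (.var 4)).cost + (mergeStep T a).flatCost

theorem mergeRuns_spec (hT : Compares pt T σ key) {a : ℕ} (ha : a ≠ 4) {s : Store}
    {A : ℕ → ℕ} {lo mid hi : ℕ} (hσ : ∀ x, 30 ≤ x → s.var x = σ x) (hA : s.arr a = A)
    (h3 : s.var 3 = mid) (h4 : s.var 4 = hi) (h5 : s.var 5 = lo) (h6 : s.var 6 = mid)
    (h7 : s.var 7 = lo) (hlm : lo ≤ mid) (hmh : mid ≤ hi)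
    (hl : ∀ x y, lo ≤ x → x < y → y < mid → key (A x) ≤ key (A y))
    (hr : ∀ x y, mid ≤ x → x < y → y < hi → key (A x) ≤ key (A y)) :
    Runs pt (mergeRuns T a) s ((hi - lo + 1) * mergeConst T a) fun s' =>
      (∀ y, (y < lo ∨ hi ≤ y) → s'.arr 4 y = s.arr 4 y) ∧
      MergeState key A (s'.arr 4) lo mid hi mid hi hi := by
  have key_step := Runs.loop_fuel (pt := pt) (b := .natLt (.var 7) (.var 4)) (p := mergeStep T a)
    (T := (mergeStep T a).flatCost)
    (Inv := fun m s' => (∀ x, 30 ≤ x → s'.var x = σ x) ∧ s'.arr a = A ∧ s'.var 3 = mid ∧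
      s'.var 4 = hi ∧ s'.var 7 + m = hi ∧ lo ≤ s'.var 7 ∧
      (∀ y, (y < lo ∨ hi ≤ y) → s'.arr 4 y = s.arr 4 y) ∧
      MergeState key A (s'.arr 4) lo mid hi (s'.var 5) (s'.var 6) (s'.var 7)) ?_ (hi - lo) s ?_
  · refine key_step.mono ?_ ?_
    · rw [mergeConst, Nat.succ_mul]; omega
    · rintro s' ⟨⟨m, -, -, -, e4, e7, -, e8, e9⟩, hb⟩
      simp only [Test.Holds, NatExpr.eval, e4, not_lt] at hb
      refine ⟨e8, ?_⟩
      have c1 := e9.count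
      have c2 := e9.le_mid
      have c3 := e9.le_hi
      have c4 := e9.mid_le
      have d5 : s'.var 5 = mid := by omega
      have d6 : s'.var 6 = hi := by omega
      have d7 : s'.var 7 = hi := by omega
      rwa [d5, d6, d7] at e9
  · rintro m s' ⟨i0, i1, i3, i4, i7, i7', i8, i9⟩ hb
    simp only [Test.Holds, NatExpr.eval, i4] at hb
    have hcmp := hT s' i0 (.get a (.var 6)) (.get a (.var 5))
    simp only [NatExpr.eval, i1] at hcmp
    have c1 := i9.count
    have c2 := i9.le_mid
    have c3 := i9.le_hi
    have c4 := i9.mid_le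
    have c5 := i9.lo_le
    refine Runs.of_loopFree (by simp [mergeStep]) ⟨m - 1, by omega, ?_⟩
    simp only [mergeStep, Prog.run, Test.Holds, NatExpr.eval, i3, i4, hcmp, not_and, not_lt]
    have hout : ∀ v y, (y < lo ∨ hi ≤ y) →
        Function.update (s'.arr 4) (s'.var 7) v y = s.arr 4 y := by
      intro v y hy
      rw [Function.update_of_ne (by omega), i8 y hy]
    split_ifs with hc
    · obtain ⟨hc1, hc2⟩ := hc
      have hpush := i9.push (e := s'.var 5) (i' := s'.var 5 + 1) (j' := s'.var 6) (by omega)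
        (by omega) (by omega) (by omega) le_rfl (by omega) (by omega)
        (fun y h1 h2 => i9.le_left y _ h1 h2 le_rfl hc1)
        (fun x h1 h2 => hl _ _ (by omega) (by omega) (by omega))
        (fun x h1 h2 => ?_) (fun x h1 h2 => by omega) (fun x h1 h2 => .inr h1)
      · simp [ha, i1, i3, i4]
        refine ⟨fun x hx => ?_, by omega, by omega, fun y hy => hout _ y hy, hpush⟩
        rw [if_neg (by omega), if_neg (by omega), i0 x hx]
      · rcases h1.eq_or_lt with rfl | h1
        · exact hc2 h2
        · exact (hc2 (by omega)).trans (hr _ _ (by omega) h1 h2)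
    · have hc' : s'.var 6 < hi ∧
          (s'.var 5 < mid → key (A (s'.var 6)) < key (A (s'.var 5))) := by
        by_cases hm : s'.var 5 < mid
        · simp only [hm, true_and, not_forall, not_le] at hc
          exact ⟨hc.1, fun _ => hc.2⟩
        · exact ⟨by omega, fun h => absurd h hm⟩
      obtain ⟨hc1, hc2⟩ := hc'
      have hpush := i9.push (e := s'.var 6) (i' := s'.var 5) (j' := s'.var 6 + 1) (by omega)
        (by omega) le_rfl (by omega) (by omega) (by omega) (by omega)
        (fun y h1 h2 => i9.le_right y _ h1 h2 le_rfl hc1)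
        (fun x h1 h2 => ?_) (fun x h1 h2 => hr _ _ (by omega) (by omega) (by omega))
        (fun x h1 h2 => .inr h1) (fun x h1 h2 => by omega)
      · simp [ha, i1, i3, i4]
        refine ⟨fun x hx => ?_, by omega, by omega, fun y hy => hout _ y hy, hpush⟩
        rw [if_neg (by omega), if_neg (by omega), i0 x hx]
      · refine (hc2 (by omega)).le.trans ?_
        rcases h1.eq_or_lt with rfl | h1
        · exact le_rfl
        · exact hl _ _ (by omega) h1 h2
  · refine ⟨hσ, hA, h3, h4, by omega, by omega, fun _ _ => rfl, ?_⟩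
    rw [h5, h6, h7]
    exact ⟨le_rfl, hlm, le_rfl, hmh, by omega, fun _ _ _ _ _ => by omega,
      fun _ _ _ _ => by omega, fun _ _ _ _ => by omega, fun _ _ _ => by omega,
      fun x h1 h2 => .inr (by omega)⟩

end MergeSort

section MergeSort

variable {κ : Type*} [LinearOrder κ]

/-- The blocks `[q * w, q * w + w)` of `A` on `[0, n)` are sorted. -/
def BlockSorted (key : ℕ → κ) (A : ℕ → ℕ) (n w : ℕ) : Prop :=
  ∀ q x y, q * w ≤ x → x < y → y < q * w + w → y < n → key (A x) ≤ key (A y)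

/-- `A` and `B` have the same values on `[0, n)`. -/
def SameValues (A B : ℕ → ℕ) (n : ℕ) : Prop :=
  (∀ y < n, ∃ x < n, B y = A x) ∧ ∀ x < n, ∃ y < n, B y = A x

theorem SameValues.trans {A B C : ℕ → ℕ} {n : ℕ} (h : SameValues A B n) (h' : SameValues B C n) :
    SameValues A C n := by
  constructor
  · intro y hy
    obtain ⟨x, hx, e⟩ := h'.1 y hy
    obtain ⟨z, hz, e'⟩ := h.1 x hx
    exact ⟨z, hz, e.trans e'⟩
  · intro x hx
    obtain ⟨y, hy, e⟩ := h.2 x hx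
    obtain ⟨z, hz, e'⟩ := h'.2 y hy
    exact ⟨z, hz, e'.trans e⟩

variable {pt : ℕ → Plane} {T : NatExpr → NatExpr → Test} {σ : ℕ → ℕ} {key : ℕ → κ}

/-- Set up the merge of the two runs that start at variable `2`. -/
def mergeSetup : Prog :=
  .seq (.set 3 (.sub (.add (.var 2) (.var 1)) (.sub (.add (.var 2) (.var 1)) (.var 0))))
    (.seq (.set 4 (.sub (.add (.var 3) (.var 1)) (.sub (.add (.var 3) (.var 1)) (.var 0))))
      (.seq (.set 5 (.var 2)) (.seq (.set 6 (.var 3)) (.set 7 (.var 2)))))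

def mergePass (T : NatExpr → NatExpr → Test) (a : ℕ) : Prog :=
  .seq (.set 2 (.const 0)) (.loop (.natLt (.var 2) (.var 0))
    (.seq mergeSetup (.seq (mergeRuns T a) (.set 2 (.var 4)))))

theorem mergeRuns_keepsVar {a x : ℕ} (h5 : x ≠ 5) (h6 : x ≠ 6) (h7 : x ≠ 7) :
    (mergeRuns T a).KeepsVar x := by
  simp [mergeRuns, mergeStep, h5, h6, h7]

theorem mergeRuns_keepsArr {a b : ℕ} (h : b ≠ 4) : (mergeRuns T a).KeepsArr b := by
  simp [mergeRuns, mergeStep, h]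

def passConst (T : NatExpr → NatExpr → Test) (a : ℕ) : ℕ :=
  1 + (Test.natLt (.var 2) (.var 0)).cost + mergeSetup.flatCost + 2 * mergeConst T a +
    (Prog.set 2 (.var 4)).flatCost + (Prog.set 2 (.const 0)).flatCost

theorem mergePass_spec (hT : Compares pt T σ key) {a : ℕ} (ha : a ≠ 4) {s : Store}
    {A : ℕ → ℕ} {n w : ℕ} (hσ : ∀ x, 30 ≤ x → s.var x = σ x) (hA : s.arr a = A)
    (h0 : s.var 0 = n) (h1 : s.var 1 = w) (hw : 0 < w) (hs : BlockSorted key A n w) :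
    Runs pt (mergePass T a) s ((n + 1) * passConst T a) fun s' =>
      BlockSorted key (s'.arr 4) n (w + w) ∧ SameValues A (s'.arr 4) n := by
  have hloop := Runs.loop_potential (pt := pt) (b := .natLt (.var 2) (.var 0))
    (p := .seq mergeSetup (.seq (mergeRuns T a) (.set 2 (.var 4))))
    (Inv := fun Φ s' => (∀ x, 30 ≤ x → s'.var x = σ x) ∧ s'.arr a = A ∧ s'.var 0 = n ∧
      s'.var 1 = w ∧ (n - s'.var 2) * passConst T a ≤ Φ ∧
      (∃ q, s'.var 2 = min (q * (w + w)) n) ∧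
      (∀ q x y, q * (w + w) ≤ x → x < y → y < q * (w + w) + (w + w) → y < s'.var 2 →
        key (s'.arr 4 x) ≤ key (s'.arr 4 y)) ∧ SameValues A (s'.arr 4) (s'.var 2))
    ?_ (n * passConst T a) ((Prog.set 2 (.const 0)).run pt s) ?_
  · refine (Runs.seq_loopFree (by simp) hloop).mono ?_ ?_
    · rw [Nat.succ_mul]
      have : (Prog.set 2 (.const 0)).flatCost + (1 + (Test.natLt (.var 2) (.var 0)).cost) ≤
        passConst T a := by unfold passConst; omega
      omega
    · rintro s' ⟨⟨Φ, -, -, e0, -, -, ⟨q, e2⟩, e3, e4⟩, hb⟩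
      simp only [Test.Holds, NatExpr.eval, not_lt, e0] at hb
      have e5 : s'.var 2 = n := by omega
      rw [e5] at e3 e4
      exact ⟨e3, e4⟩
  · rintro Φ s' ⟨i0, iA, in0, iw, iΦ, ⟨q, i2⟩, i3, i4⟩ hb
    simp only [Test.Holds, NatExpr.eval, in0] at hb
    set lo := s'.var 2 with hlo
    have hloq : lo = q * (w + w) := by omega
    have hloq1 : lo = (2 * q) * w := by rw [hloq]; ring
    have hloq2 : lo + w = (2 * q + 1) * w := by rw [hloq]; ring
    obtain ⟨s₁, hs₁⟩ : ∃ s₁, s₁ = mergeSetup.run pt s' := ⟨_, rfl⟩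
    have v3 : s₁.var 3 = min (lo + w) n := by
      simp [hs₁, mergeSetup, iw, in0, ← hlo]; omega
    have v4 : s₁.var 4 = min (lo + w + w) n := by
      simp [hs₁, mergeSetup, iw, in0, ← hlo]; omega
    have v5 : s₁.var 5 = lo := by simp [hs₁, mergeSetup, ← hlo]
    have v6 : s₁.var 6 = min (lo + w) n := by
      simp [hs₁, mergeSetup, iw, in0, ← hlo]; omega
    have v7 : s₁.var 7 = lo := by simp [hs₁, mergeSetup, ← hlo]
    have v0 : s₁.var 0 = n := by simp [hs₁, mergeSetup, in0]
    have v1 : s₁.var 1 = w := by simp [hs₁, mergeSetup, iw]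
    have vσ : ∀ x, 30 ≤ x → s₁.var x = σ x := by
      intro x hx
      rw [← i0 x hx, hs₁]
      exact Prog.LoopFree.run_var (by simp [mergeSetup]) (by simp [mergeSetup]; omega)
    have vA : s₁.arr a = A := by simp [hs₁, mergeSetup, iA]
    have vB : s₁.arr 4 = s'.arr 4 := by simp [hs₁, mergeSetup]
    have hmerge := (mergeRuns_spec hT ha vσ vA v3 v4 v5 v6 v7 (by omega) (by omega)
      (fun x y hx hxy hy => hs (2 * q) x y (by omega) hxy (by omega) (by omega))
      (fun x y hx hxy hy => hs (2 * q + 1) x y (by omega) hxy (by omega) (by omega))).frame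
    refine ⟨_, Runs.seq_loopFree (by simp [mergeSetup]) (Runs.seq (T' :=
      (Prog.set 2 (.var 4)).flatCost) (hs₁ ▸ hmerge.mono le_rfl ?_))⟩
    rintro s₂ ⟨⟨o1, o2⟩, o3, o4⟩
    refine Runs.of_loopFree (by simp) ?_
    have u0 : s₂.var 0 = n := (o3 0 (mergeRuns_keepsVar (by simp) (by simp) (by simp))).trans v0
    have u1 : s₂.var 1 = w := (o3 1 (mergeRuns_keepsVar (by simp) (by simp) (by simp))).trans v1
    have u4 : s₂.var 4 = _ := (o3 4 (mergeRuns_keepsVar (by simp) (by simp) (by simp))).trans v4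
    have uσ : ∀ x, 30 ≤ x → s₂.var x = σ x := fun x hx =>
      (o3 x (mergeRuns_keepsVar (by omega) (by omega) (by omega))).trans (vσ x hx)
    have uA : s₂.arr a = A := (o4 a (mergeRuns_keepsArr ha)).trans vA
    rw [vB] at o1
    set hi := min (lo + w + w) n with hhi
    refine ⟨(n - hi) * passConst T a, ?_, ?_, ?_, ?_, ?_, ?_, ⟨q + 1, ?_⟩, ?_, ?_⟩
    · refine le_trans ?_ iΦ
      have : n - lo = (hi - lo) + (n - hi) := by omega
      have e : (n - lo) * passConst T a =
          (hi - lo) * passConst T a + (n - hi) * passConst T a := by rw [this, Nat.add_mul]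
      rw [e]
      refine Nat.add_le_add_right ?_ _
      obtain ⟨d, hd⟩ : ∃ d, hi - lo = d + 1 := ⟨hi - lo - 1, by omega⟩
      rw [hd]
      unfold passConst
      have e1 : d * (mergeConst T a) ≤ d * passConst T a :=
        Nat.mul_le_mul_left _ (by unfold passConst; omega)
      unfold passConst at e1
      simp only [Nat.add_mul, Nat.one_mul, Nat.mul_add] at e1 ⊢
      omega
    · intro x hx
      simp
      rw [if_neg (by omega), uσ x hx]
    · simpa using uA
    · simpa using u0
    · simpa using u1
    · simp [u4]
    · simp only [Prog.run, Store.set_var, NatExpr.eval, u4, if_true]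
      rw [Nat.succ_mul, ← hloq, hhi, Nat.add_assoc]
    · intro q' x y h1 h2 h3 h4
      simp only [Prog.run, Store.set_var, Store.set_arr, NatExpr.eval, u4, if_true] at h4 ⊢
      by_cases hy : y < lo
      · rw [o1 x (by omega), o1 y (by omega)]
        exact i3 q' x y h1 h2 h3 hy
      · by_cases hx : x < lo
        · exfalso
          have a1 : q' * (w + w) < q * (w + w) := by omega
          have a2 : q' < q := lt_of_mul_lt_mul_right a1 (Nat.zero_le _)
          have a3 : (q' + 1) * (w + w) ≤ q * (w + w) := Nat.mul_le_mul_right _ a2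
          rw [Nat.succ_mul] at a3
          omega
        · exact o2.sorted x y (by omega) h2 h4
    · simp only [Prog.run, Store.set_var, Store.set_arr, NatExpr.eval, u4, if_true]
      constructor
      · intro y hy
        by_cases hyl : y < lo
        · obtain ⟨x, hx, e⟩ := i4.1 y hyl
          exact ⟨x, by omega, by rw [o1 y (.inl hyl), e]⟩
        · obtain ⟨x, -, hx, e⟩ := o2.source y (by omega) hy
          exact ⟨x, hx, e⟩
      · intro x hx
        by_cases hxl : x < lo
        · obtain ⟨y, hy, e⟩ := i4.2 x hxl
          exact ⟨y, by omega, by rw [o1 y (.inl hy), e]⟩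
        · rcases o2.target x (by omega) hx with ⟨y, -, hy, e⟩ | h | h
          · exact ⟨y, hy, e⟩
          · omega
          · omega
  · refine ⟨fun x hx => ?_, by simpa using hA, by simpa using h0, by simpa using h1, ?_,
      ⟨0, by simp⟩, ?_, ?_⟩
    · simp
      rw [if_neg (by omega), hσ x hx]
    · simp
    · simp
    · simp [SameValues]

/-- Copy the first cells of array `4` to array `a`. -/
def copyBack (a : ℕ) : Prog :=
  .seq (.set 7 (.const 0)) (.loop (.natLt (.var 7) (.var 0))
    (.seq (.put a (.var 7) (.get 4 (.var 7))) (.set 7 (.add (.var 7) (.const 1)))))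

theorem copyBack_spec {a : ℕ} (ha : a ≠ 4) : ∃ C, ∀ (pt : ℕ → Plane) (s : Store) (n : ℕ),
    s.var 0 = n → Runs pt (copyBack a) s ((n + 1) * C) fun s' =>
      ∀ x < n, s'.arr a x = s.arr 4 x := by
  let b : Test := .natLt (.var 7) (.var 0)
  let p : Prog := .seq (.put a (.var 7) (.get 4 (.var 7))) (.set 7 (.add (.var 7) (.const 1)))
  refine ⟨(Prog.set 7 (.const 0)).flatCost + (1 + b.cost + p.flatCost) + (1 + b.cost),
    fun pt s n h0 => ?_⟩
  have hloop := Runs.loop_fuel (pt := pt) (b := b) (p := p) (T := p.flatCost)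
    (Inv := fun m s' => s'.var 0 = n ∧ s'.var 7 + m = n ∧ s'.arr 4 = s.arr 4 ∧
      ∀ x < s'.var 7, s'.arr a x = s.arr 4 x) ?_ n ((Prog.set 7 (.const 0)).run pt s) ?_
  · refine (Runs.seq_loopFree (by simp) hloop).mono ?_ ?_
    · ring_nf; omega
    · rintro s' ⟨⟨m, e0, e1, -, e2⟩, hb⟩
      simp only [b, Test.Holds, NatExpr.eval, not_lt, e0] at hb
      exact fun x hx => e2 x (by omega)
  · rintro m s' ⟨e0, e1, e3, e2⟩ hb
    simp only [b, Test.Holds, NatExpr.eval, e0] at hb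
    refine Runs.of_loopFree (by simp [p]) ⟨m - 1, by omega, ?_⟩
    simp [p, e0, e3, Ne.symm ha]
    refine ⟨by omega, fun x hx => ?_⟩
    rcases hx.lt_or_eq with h | rfl
    · rw [Function.update_of_ne (by omega), e2 x h]
    · rw [Function.update_self]
  · simpa using h0

/-- Sort the indices `0, …, n - 1` into array `a`, with array `4` as a buffer. -/
def mergeSort (T : NatExpr → NatExpr → Test) (a : ℕ) : Prog :=
  .seq (.seq (.set 7 (.const 0)) (.loop (.natLt (.var 7) (.var 0))
      (.seq (.put a (.var 7) (.var 7)) (.set 7 (.add (.var 7) (.const 1))))))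
    (.seq (.set 1 (.const 1)) (.loop (.natLt (.var 1) (.var 0))
      (.seq (mergePass T a) (.seq (copyBack a) (.set 1 (.add (.var 1) (.var 1)))))))

theorem initIndices_spec (a : ℕ) : ∃ C, ∀ (pt : ℕ → Plane) (s : Store) (n : ℕ), s.var 0 = n →
    Runs pt (.seq (.set 7 (.const 0)) (.loop (.natLt (.var 7) (.var 0))
      (.seq (.put a (.var 7) (.var 7)) (.set 7 (.add (.var 7) (.const 1))))))
      s ((n + 1) * C) fun s' => ∀ x < n, s'.arr a x = x := by
  let b : Test := .natLt (.var 7) (.var 0)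
  let p : Prog := .seq (.put a (.var 7) (.var 7)) (.set 7 (.add (.var 7) (.const 1)))
  refine ⟨(Prog.set 7 (.const 0)).flatCost + (1 + b.cost + p.flatCost) + (1 + b.cost),
    fun pt s n h0 => ?_⟩
  have hloop := Runs.loop_fuel (pt := pt) (b := b) (p := p) (T := p.flatCost)
    (Inv := fun m s' => s'.var 0 = n ∧ s'.var 7 + m = n ∧
      ∀ x < s'.var 7, s'.arr a x = x) ?_ n ((Prog.set 7 (.const 0)).run pt s) ?_
  · refine (Runs.seq_loopFree (by simp) hloop).mono ?_ ?_
    · ring_nf; omega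
    · rintro s' ⟨⟨m, e0, e1, e2⟩, hb⟩
      simp only [b, Test.Holds, NatExpr.eval, not_lt, e0] at hb
      exact fun x hx => e2 x (by omega)
  · rintro m s' ⟨e0, e1, e2⟩ hb
    simp only [b, Test.Holds, NatExpr.eval, e0] at hb
    refine Runs.of_loopFree (by simp [p]) ⟨m - 1, by omega, ?_⟩
    simp [p, e0]
    refine ⟨by omega, fun x hx => ?_⟩
    rcases hx.lt_or_eq with h | rfl
    · rw [Function.update_of_ne (by omega), e2 x h]
    · rw [Function.update_self]
  · simpa using h0

theorem mergeSort_keepsVar {a x : ℕ} (h : 8 ≤ x ∨ x = 0) : (mergeSort T a).KeepsVar x := by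
  simp [mergeSort, mergePass, mergeSetup, mergeRuns, mergeStep, copyBack]
  omega

theorem mergeSort_keepsArr {a b : ℕ} (h : b ≠ 4) (hab : b ≠ a) : (mergeSort T a).KeepsArr b := by
  simp [mergeSort, mergePass, mergeSetup, mergeRuns, mergeStep, copyBack, h, hab]

theorem mergeSort_spec (κ : Type*) [LinearOrder κ] (T : NatExpr → NatExpr → Test) {a : ℕ}
    (ha : a ≠ 4) : ∃ C, ∀ (pt : ℕ → Plane) (σ : ℕ → ℕ) (key : ℕ → κ), Compares pt T σ key →
      ∀ (s : Store) (n : ℕ), s.var 0 = n → (∀ x, 30 ≤ x → s.var x = σ x) →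
      Runs pt (mergeSort T a) s ((n + 1) * (Nat.log 2 n + 2) * C) fun s' =>
        (∀ x y, x < y → y < n → key (s'.arr a x) ≤ key (s'.arr a y)) ∧
        (∀ x < n, s'.arr a x < n) ∧ ∀ v < n, ∃ x < n, s'.arr a x = v := by
  obtain ⟨C₁, h₁⟩ := initIndices_spec a
  obtain ⟨C₂, h₂⟩ := copyBack_spec ha
  let b : Test := .natLt (.var 1) (.var 0)
  let p : Prog := .seq (mergePass T a) (.seq (copyBack a) (.set 1 (.add (.var 1) (.var 1))))
  let u : Prog := .set 1 (.const 1)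
  let v : Prog := .set 1 (.add (.var 1) (.var 1))
  refine ⟨C₁ + u.flatCost + (1 + b.cost + (passConst T a + C₂ + v.flatCost)),
    fun pt σ key hT s n h0 hσ => ?_⟩
  have hloop : ∀ s₁ : Store, s₁.var 0 = n → (∀ x, 30 ≤ x → s₁.var x = σ x) →
      (∀ x < n, s₁.arr a x = x) → _ := fun s₁ h0 hσ hid =>
    Runs.loop_fuel (pt := pt) (b := b) (p := p)
      (T := (n + 1) * passConst T a + ((n + 1) * C₂ + v.flatCost))
      (Inv := fun m s' => (∀ x, 30 ≤ x → s'.var x = σ x) ∧ s'.var 0 = n ∧ 0 < s'.var 1 ∧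
        n ≤ s'.var 1 * 2 ^ m ∧ BlockSorted key (s'.arr a) n (s'.var 1) ∧
        SameValues id (s'.arr a) n) ?_ (Nat.log 2 n + 1) (u.run pt s₁) ?_
  · refine Runs.mono (Runs.seq ((h₁ pt s n h0).frame.mono le_rfl ?_)
      (T' := u.flatCost + ((Nat.log 2 n + 1) * (1 + b.cost +
        ((n + 1) * passConst T a + ((n + 1) * C₂ + v.flatCost))) + (1 + b.cost)))) ?_ fun _ h => h
    · rintro s₁ ⟨hid, f1, f2⟩
      refine Runs.seq_loopFree (by simp) ((hloop s₁ ?_ ?_ hid).mono le_rfl ?_)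
      · rw [f1 0 (by simp), h0]
      · intro x hx
        rw [f1 x (by simp; omega), hσ x hx]
      · rintro s' ⟨⟨m, -, e0, e1, -, e2, e3⟩, hb⟩
        simp only [b, Test.Holds, NatExpr.eval, not_lt, e0] at hb
        refine ⟨fun x y hxy hy => e2 0 x y (by simp) hxy (by omega) hy, fun x hx => ?_,
          fun v hv => e3.2 v hv⟩
        obtain ⟨y, hy, e⟩ := e3.1 x hx
        rw [e]
        exact hy
    · generalize Nat.log 2 n = l
      generalize u.flatCost = u'
      generalize v.flatCost = v'
      generalize b.cost = b'
      generalize passConst T a = c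
      have : (1 + b' + ((n + 1) * c + ((n + 1) * C₂ + v'))) ≤
        (n + 1) * (1 + b' + (c + C₂ + v')) := by
        ring_nf
        have : 0 ≤ n * b' := Nat.zero_le _
        have : 0 ≤ n * v' := Nat.zero_le _
        omega
      have h1 := Nat.mul_le_mul_left (l + 1) this
      have h2 : C₁ + u' ≤ (l + 2) * (C₁ + u') := Nat.le_mul_of_pos_left _ (by omega)
      have h3 := Nat.mul_le_mul_left (n + 1) h2
      have h4 : 1 + b' ≤ (n + 1) * (1 + b' + (c + C₂ + v')) := by
        refine le_trans ?_ (Nat.le_mul_of_pos_left _ (by omega))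
        omega
      have h5 : u' ≤ (n + 1) * u' := Nat.le_mul_of_pos_left _ (by omega)
      calc _ ≤ (n + 1) * (C₁ + u') + ((l + 1) * ((n + 1) * (1 + b' + (c + C₂ + v'))) +
              (n + 1) * (1 + b' + (c + C₂ + v'))) := by
            have e : (n + 1) * (C₁ + u') = (n + 1) * C₁ + (n + 1) * u' := Nat.mul_add ..
            omega
        _ ≤ (n + 1) * ((l + 2) * (C₁ + u')) + ((l + 1) * ((n + 1) * (1 + b' + (c + C₂ + v'))) +
              (n + 1) * (1 + b' + (c + C₂ + v'))) := by omega
        _ = _ := by ring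
  · rintro m s' ⟨i0, i1, i2, i3, i4, i5⟩ hb
    simp only [b, Test.Holds, NatExpr.eval, i1] at hb
    refine Runs.seq ((mergePass_spec hT ha i0 rfl i1 rfl i2 i4).frame.mono le_rfl ?_)
    rintro s₂ ⟨⟨o1, o2⟩, o3, o4⟩
    have k : ∀ x, x = 0 ∨ x = 1 ∨ 30 ≤ x → s₂.var x = s'.var x := by
      intro x hx
      refine o3 x ?_
      simp [mergePass, mergeSetup, mergeRuns, mergeStep]
      omega
    refine Runs.seq ((h₂ pt s₂ n (by rw [k 0 (by simp), i1])).frame.mono le_rfl ?_)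
    rintro s₃ ⟨c1, c2, -⟩
    have k' : ∀ x, x = 0 ∨ x = 1 ∨ 30 ≤ x → s₃.var x = s'.var x := by
      intro x hx
      rw [c2 x (by simp [copyBack]; omega), k x hx]
    refine Runs.of_loopFree (by simp) ⟨m - 1, ?_, ?_, ?_, ?_, ?_, ?_, ?_⟩
    · rcases m with _ | m
      · simp at i3; omega
      · omega
    · intro x hx
      simp
      rw [if_neg (by omega), k' x (by omega), i0 x hx]
    · simp [k' 0, i1]
    · simp [k' 1, i2]
    · rcases m with _ | m
      · simp at i3; omega
      · simp [k' 1]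
        rw [pow_succ] at i3
        linarith
    · intro q x y q1 q2 q3 q4
      simp [k' 1] at q1 q2 q3 q4 ⊢
      rw [c1 x (by omega), c1 y q4]
      exact o1 q x y q1 q2 q3 q4
    · refine i5.trans (o2.trans ⟨fun y hy => ⟨y, hy, ?_⟩, fun y hy => ⟨y, hy, ?_⟩⟩) <;>
      simp [c1 y hy]
  · refine ⟨?_, by simpa [u] using h0, by simp [u], ?_, ?_, ?_⟩
    · intro x hx
      simp [u]
      rw [if_neg (by omega), hσ x hx]
    · simpa [u] using (Nat.lt_pow_succ_log_self (by norm_num) n).le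
    · intro q x y q1 q2 q3 q4
      simp [u] at q1 q2 q3
      omega
    · constructor
      · intro y hy
        exact ⟨y, hy, by simp [u, hid y hy]⟩
      · intro y hy
        exact ⟨y, hy, by simp [u, hid y hy]⟩

end MergeSort

/-! ### Farthest pairs -/

/-- The lexicographic order of points with given indices. -/
def LexLT (pt : ℕ → Plane) (a b : ℕ) : Prop :=
  pt a 0 < pt b 0 ∨ pt a 0 = pt b 0 ∧ pt a 1 < pt b 1

/-- The squared distance of points with given indices. -/
noncomputable def sqDist (pt : ℕ → Plane) (a b : ℕ) : ℝ :=
  (pt a 0 - pt b 0) * (pt a 0 - pt b 0) + (pt a 1 - pt b 1) * (pt a 1 - pt b 1)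

/-- The cross product of the vectors from `a` to `b` and from `c` to `d`. -/
noncomputable def cross (pt : ℕ → Plane) (a b c d : ℕ) : ℝ :=
  (pt b 0 - pt a 0) * (pt d 1 - pt c 1) - (pt d 0 - pt c 0) * (pt b 1 - pt a 1)

def RealExpr.sqDist (a b : NatExpr) : RealExpr :=
  .add (.mul (.sub (.coord 0 a) (.coord 0 b)) (.sub (.coord 0 a) (.coord 0 b)))
    (.mul (.sub (.coord 1 a) (.coord 1 b)) (.sub (.coord 1 a) (.coord 1 b)))

def RealExpr.cross (a b c d : NatExpr) : RealExpr :=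
  .sub (.mul (.sub (.coord 0 b) (.coord 0 a)) (.sub (.coord 1 d) (.coord 1 c)))
    (.mul (.sub (.coord 0 d) (.coord 0 c)) (.sub (.coord 1 b) (.coord 1 a)))

@[simp] theorem RealExpr.eval_sqDist (pt : ℕ → Plane) (s : Store) (a b : NatExpr) :
    (RealExpr.sqDist a b).eval pt s = _root_.sqDist pt (a.eval s) (b.eval s) := rfl

@[simp] theorem RealExpr.eval_cross (pt : ℕ → Plane) (s : Store) (a b c d : NatExpr) :
    (RealExpr.cross a b c d).eval pt s =
      _root_.cross pt (a.eval s) (b.eval s) (c.eval s) (d.eval s) := rfl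

def Test.disj (b d : Test) : Test := .neg (.conj (.neg b) (.neg d))

@[simp] theorem Test.holds_disj (pt : ℕ → Plane) (s : Store) (b d : Test) :
    (b.disj d).Holds pt s ↔ b.Holds pt s ∨ d.Holds pt s := by
  simp only [Test.disj, Test.Holds]
  tauto

theorem sqDist_nonneg (pt : ℕ → Plane) (a b : ℕ) : 0 ≤ sqDist pt a b :=
  add_nonneg (mul_self_nonneg _) (mul_self_nonneg _)

theorem sqDist_comm (pt : ℕ → Plane) (a b : ℕ) : sqDist pt a b = sqDist pt b a := by
  unfold sqDist; ring

/-- Of two vectors in the right half-plane, one with a negative and one with a nonnegative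
component along a vector in the upper half-plane, the first is clockwise of the second. -/
theorem cross_pos_of_dot {x₁ y₁ x₂ y₂ v w : ℝ} (h₁ : 0 < x₁ ∨ x₁ = 0 ∧ 0 < y₁)
    (h₂ : 0 < x₂ ∨ x₂ = 0 ∧ 0 < y₂) (hv : 0 < w ∨ w = 0 ∧ 0 < v)
    (hn : x₁ * v + y₁ * w < 0) (hp : 0 ≤ x₂ * v + y₂ * w) : 0 < x₁ * y₂ - x₂ * y₁ := by
  rcases hv with hw | ⟨rfl, hv⟩
  · rcases h₁ with hx₁ | ⟨rfl, hy₁⟩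
    · have key : 0 < w * (x₁ * y₂ - x₂ * y₁) := by
        rcases h₂ with hx₂ | ⟨rfl, hy₂⟩
        · have := mul_nonneg hx₁.le hp
          have := mul_neg_of_pos_of_neg hx₂ hn
          nlinarith
        · have := mul_pos hw (mul_pos hx₁ hy₂)
          nlinarith
      exact (mul_pos_iff_of_pos_left hw).1 key
    · have := mul_pos hy₁ hw
      linarith
  · rcases h₁ with hx₁ | ⟨rfl, hy₁⟩
    · have := mul_pos hx₁ hv
      linarith
    · simp at hn

/-! #### The stack loop for one chain of the convex hull -/

/-- The state of the stack loop: the first `t` cells of `X` have been processed, the stack is `U`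
with height `u`. Elements of `X` outside `inQ` are skipped, and an element is removed from the
stack only if `pop` holds for it and its neighbors. -/
structure HullState (lt : ℕ → ℕ → Prop) (pop : ℕ → ℕ → ℕ → Prop) (inQ : ℕ → Prop) (X : ℕ → ℕ)
    (n t u : ℕ) (U : ℕ → ℕ) : Prop where
  le : t ≤ n
  height : u ≤ t
  mem : ∀ i < u, ∃ x < t, U i = X x ∧ inQ (X x)
  sorted : ∀ i j, i < j → j < u → lt (U i) (U j)
  noPop : ∀ i, i + 2 < u → ¬ pop (U i) (U (i + 1)) (U (i + 2))
  pos : ∀ x < t, inQ (X x) → 0 < u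
  protected_mem : ∀ x < t, inQ (X x) → (∀ y z, y < n → z < n → inQ (X y) → inQ (X z) →
    lt (X y) (X x) → lt (X x) (X z) → ¬ pop (X y) (X x) (X z)) → ∃ i < u, U i = X x

def hullStep (F P : Test) (a u : ℕ) : Prog :=
  .cond F (.set 14 (.add (.var 14) (.const 1)))
    (.cond (.conj (.natLt (.const 1) (.var u)) P)
      (.set u (.sub (.var u) (.const 1)))
      (.seq (.put a (.var u) (.get 2 (.var 14)))
        (.seq (.set u (.add (.var u) (.const 1))) (.set 14 (.add (.var 14) (.const 1))))))

def hullLoop (F P : Test) (a u : ℕ) : Prog :=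
  .seq (.seq (.set 14 (.const 0)) (.set u (.const 0)))
    (.loop (.natLt (.var 14) (.var 0)) (hullStep F P a u))

theorem hullLoop_spec (F P : Test) {a u : ℕ} (ha : a ≠ 2) (hu : u ≠ 14) (hu0 : u ≠ 0)
    (hu13 : u ≠ 13) (hu30 : u < 30) : ∃ C, ∀ (pt : ℕ → Plane) (lt : ℕ → ℕ → Prop)
    (pop : ℕ → ℕ → ℕ → Prop) (inQ : ℕ → Prop) (X : ℕ → ℕ) (n : ℕ) (s : Store),
    (∀ s' : Store, (∀ x, x = 13 ∨ 30 ≤ x → s'.var x = s.var x) →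
      (F.Holds pt s' ↔ ¬ inQ (s'.arr 2 (s'.var 14)))) →
    (∀ s' : Store, P.Holds pt s' ↔ pop (s'.arr a (s'.var u - 2)) (s'.arr a (s'.var u - 1))
      (s'.arr 2 (s'.var 14))) →
    s.var 0 = n → s.arr 2 = X → (∀ x y, x < y → y < n → lt (X x) (X y)) →
    Runs pt (hullLoop F P a u) s ((n + 1) * C) fun s' =>
      HullState lt pop inQ X n n (s'.var u) (s'.arr a) := by
  let b : Test := .natLt (.var 14) (.var 0)
  let p := hullStep F P a u
  let i : Prog := .seq (.set 14 (.const 0)) (.set u (.const 0))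
  refine ⟨i.flatCost + 2 * (1 + b.cost + p.flatCost) + (1 + b.cost),
    fun pt lt pop inQ X n s hF hP h0 hX hlt => ?_⟩
  have hloop := Runs.loop_fuel (pt := pt) (b := b) (p := p) (T := p.flatCost)
    (Inv := fun m s' => (∀ x, x = 13 ∨ 30 ≤ x → s'.var x = s.var x) ∧ s'.var 0 = n ∧
      s'.arr 2 = X ∧ 2 * (n - s'.var 14) + s'.var u = m ∧
      HullState lt pop inQ X n (s'.var 14) (s'.var u) (s'.arr a)) ?_ (2 * n) (i.run pt s) ?_
  · refine (Runs.seq_loopFree (p := i) (by simp [i]) hloop).mono ?_ ?_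
    · ring_nf; omega
    · rintro s' ⟨⟨m, -, e0, -, -, e⟩, hb⟩
      simp only [b, Test.Holds, NatExpr.eval, not_lt, e0] at hb
      rwa [show s'.var 14 = n from le_antisymm e.le hb] at e
  · rintro m s' ⟨iσ, i0, i2, im, ih⟩ hb
    simp only [b, Test.Holds, NatExpr.eval, i0] at hb
    have hfin : p.LoopFree := by simp [p, hullStep]
    have hk : ∀ x, x ≠ 14 → x ≠ u → (p.run pt s').var x = s'.var x :=
      fun x hx hx' => hfin.run_var (by simp [p, hullStep, hx, hx'])
    have hk2 : (p.run pt s').arr 2 = X := by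
      obtain ⟨_, -, h⟩ := hfin.exec pt s'
      rw [h.arr_eq (a := 2) (by simpa [p, hullStep] using ha.symm), i2]
    refine Runs.of_loopFree hfin ⟨_, ?_, ?_, (hk 0 (by simp) hu0.symm).trans i0, hk2, rfl, ?_⟩
    rotate_left
    · intro x hx
      rw [hk x (by omega) (by omega), iσ x hx]
    · have hF' := hF s' iσ
      have hP' := hP s'
      rw [i2] at hF' hP'
      by_cases c1 : F.Holds pt s'
      · simp only [p, hullStep, Prog.run_cond_pos c1]
        rw [hF'] at c1
        simp [hu]
        exact ⟨hb, ih.height.trans (by omega), fun i hi => by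
            obtain ⟨x, hx, e⟩ := ih.mem i hi
            exact ⟨x, by omega, e⟩, ih.sorted, ih.noPop, fun x hx hq => by
            rcases Nat.lt_succ_iff_lt_or_eq.1 hx with h | rfl
            · exact ih.pos x h hq
            · exact absurd hq c1, fun x hx hq => by
            rcases Nat.lt_succ_iff_lt_or_eq.1 hx with h | rfl
            · exact ih.protected_mem x h hq
            · exact absurd hq c1⟩
      have hin : inQ (X (s'.var 14)) := by simpa [hF'] using c1
      simp only [p, hullStep, Prog.run_cond_neg c1]
      by_cases c2 : (Test.conj (.natLt (.const 1) (.var u)) P).Holds pt s'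
      · rw [Prog.run_cond_pos c2]
        simp only [Test.Holds, NatExpr.eval, hP'] at c2
        simp [Ne.symm hu]
        refine ⟨ih.le, by have := ih.height; omega, fun i hi => ih.mem i (by omega),
          fun i j hij hj => ih.sorted i j hij (by omega), fun i hi => ih.noPop i (by omega),
          fun x hx hq => by omega, ?_⟩
        intro x hx hq hprot
        obtain ⟨i, hi, e⟩ := ih.protected_mem x hx hq hprot
        by_cases hiu : i = s'.var u - 1
        · exfalso
          obtain ⟨y, hy, ey, hqy⟩ := ih.mem (s'.var u - 2) (by omega)
          have hpop := c2.2
          rw [← hiu, e, ey] at hpop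
          refine hprot y (s'.var 14) (by omega) hb hqy hin ?_ (hlt _ _ hx hb) hpop
          rw [← e, ← ey]
          exact ih.sorted _ _ (by omega) hi
        · exact ⟨i, by omega, e⟩
      · rw [Prog.run_cond_neg c2]
        simp only [Test.Holds, NatExpr.eval, hP'] at c2
        simp [Ne.symm hu, hu, i2]
        refine ⟨hb, by have := ih.height; omega, fun i hi => ?_, fun i j hij hj => ?_,
          fun i hi => ?_, fun _ _ _ => by omega, fun x hx hq hprot => ?_⟩
        · rcases Nat.lt_succ_iff_lt_or_eq.1 hi with h | rfl
          · rw [Function.update_of_ne (by omega)]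
            obtain ⟨x, hx, e⟩ := ih.mem i h
            exact ⟨x, by omega, e⟩
          · exact ⟨s'.var 14, by omega, by rw [Function.update_self], hin⟩
        · rcases Nat.lt_succ_iff_lt_or_eq.1 hj with h | rfl
          · rw [Function.update_of_ne (by omega), Function.update_of_ne (by omega)]
            exact ih.sorted i j hij h
          · rw [Function.update_of_ne (by omega), Function.update_self]
            obtain ⟨x, hx, e, -⟩ := ih.mem i hij
            rw [e]
            exact hlt _ _ hx hb
        · rcases Nat.lt_succ_iff_lt_or_eq.1 hi with h | h
          · rw [Function.update_of_ne (by omega), Function.update_of_ne (by omega),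
              Function.update_of_ne (by omega)]
            exact ih.noPop i h
          · rw [Function.update_of_ne (by omega), Function.update_of_ne (by omega), h,
              Function.update_self]
            intro hpop
            refine c2 ⟨by omega, ?_⟩
            rwa [show s'.var u - 2 = i by omega, show s'.var u - 1 = i + 1 by omega]
        · rcases Nat.lt_succ_iff_lt_or_eq.1 hx with h | rfl
          · obtain ⟨i, hi, e⟩ := ih.protected_mem x h hq hprot
            exact ⟨i, by omega, by rw [Function.update_of_ne (by omega), e]⟩
          · exact ⟨s'.var u, by omega, Function.update_self ..⟩
    · by_cases c1 : F.Holds pt s'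
      · simp only [p, hullStep, Prog.run_cond_pos c1]
        simp [hu]; omega
      simp only [p, hullStep, Prog.run_cond_neg c1]
      by_cases c2 : (Test.conj (.natLt (.const 1) (.var u)) P).Holds pt s'
      · rw [Prog.run_cond_pos c2]
        simp only [Test.Holds, NatExpr.eval] at c2
        simp [Ne.symm hu]; omega
      · rw [Prog.run_cond_neg c2]
        simp [Ne.symm hu, hu]; omega
  · refine ⟨fun x hx => ?_, ?_, ?_, ?_, ?_⟩
    · have h1 : x ≠ u := by omega
      have h2 : x ≠ 14 := by omega
      simp [i, h1, h2]
    · simp [i, hu0.symm, h0]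
    · simp [i, hX]
    · simp [i, hu.symm]
    · simp [i, hu.symm]
      exact ⟨by omega, le_rfl, fun i hi => by omega, fun i j _ _ => by omega,
        fun i hi => by omega, fun x hx => by omega, fun x hx => by omega⟩

/-! #### The walk along antipodal pairs -/

/-- One step of the walk: the position is advanced on one of the two chains, and the current
pair is recorded if it is farther apart than the recorded pair. -/
def walkStep : Prog :=
  .seq (.cond (.conj (.natLt (.add (.var 18) (.const 1)) (.var 16))
      (.disj (.natEq (.var 19) (.const 0))
        (.realLt (.const 0) (.cross (.get 6 (.sub (.var 19) (.const 1))) (.get 6 (.var 19))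
          (.get 5 (.var 18)) (.get 5 (.add (.var 18) (.const 1)))))))
      (.set 18 (.add (.var 18) (.const 1)))
      (.set 19 (.sub (.var 19) (.const 1))))
    (.cond (.realLt (.sqDist (.var 20) (.var 21)) (.sqDist (.get 5 (.var 18)) (.get 6 (.var 19))))
      (.seq (.set 20 (.get 5 (.var 18))) (.set 21 (.get 6 (.var 19)))) .skip)

def walkInit : Prog :=
  .seq (.set 18 (.const 0)) (.seq (.set 19 (.sub (.var 17) (.const 1)))
    (.seq (.set 20 (.get 5 (.const 0))) (.set 21 (.get 6 (.var 19)))))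

def walkTest : Test :=
  .disj (.natLt (.add (.var 18) (.const 1)) (.var 16)) (.natLt (.const 0) (.var 19))

def walk : Prog := .seq walkInit (.loop walkTest walkStep)

theorem walk_spec : ∃ C, ∀ (pt : ℕ → Plane) (s : Store) (U L : ℕ → ℕ) (u l : ℕ),
    s.var 16 = u → s.var 17 = l → s.arr 5 = U → s.arr 6 = L → 0 < u → 0 < l →
    Runs pt walk s ((u + l) * C) fun s' =>
      (∃ i < u, s'.var 20 = U i) ∧ (∃ j < l, s'.var 21 = L j) ∧ ∀ i₀ < u, ∀ j₀ < l,
        (∀ i < i₀, 0 < j₀ → 0 < cross pt (L (j₀ - 1)) (L j₀) (U i) (U (i + 1))) →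
        (∀ j, j₀ < j → j < l → i₀ + 1 < u →
          cross pt (L (j - 1)) (L j) (U i₀) (U (i₀ + 1)) ≤ 0) →
        sqDist pt (U i₀) (L j₀) ≤ sqDist pt (s'.var 20) (s'.var 21) := by
  refine ⟨walkInit.flatCost + (1 + walkTest.cost + walkStep.flatCost) + (1 + walkTest.cost),
    fun pt s U L u l h16 h17 h5 h6 hu hl => ?_⟩
  have hloop := Runs.loop_fuel (pt := pt) (b := walkTest) (p := walkStep) (T := walkStep.flatCost)
    (Inv := fun m s' => s'.var 16 = u ∧ s'.arr 5 = U ∧ s'.arr 6 = L ∧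
      s'.var 18 < u ∧ s'.var 19 < l ∧ m = (u - s'.var 18) + s'.var 19 ∧
      (∃ i < u, s'.var 20 = U i) ∧ (∃ j < l, s'.var 21 = L j) ∧
      sqDist pt (U (s'.var 18)) (L (s'.var 19)) ≤ sqDist pt (s'.var 20) (s'.var 21) ∧
      ∀ i₀ < u, ∀ j₀ < l,
        (∀ i < i₀, 0 < j₀ → 0 < cross pt (L (j₀ - 1)) (L j₀) (U i) (U (i + 1))) →
        (∀ j, j₀ < j → j < l → i₀ + 1 < u →
          cross pt (L (j - 1)) (L j) (U i₀) (U (i₀ + 1)) ≤ 0) →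
        (s'.var 18 ≤ i₀ ∧ j₀ ≤ s'.var 19) ∨
          sqDist pt (U i₀) (L j₀) ≤ sqDist pt (s'.var 20) (s'.var 21))
    ?_ (u + (l - 1)) (walkInit.run pt s) ?_
  · refine (Runs.seq_loopFree (by simp [walkInit]) hloop).mono ?_ ?_
    · have h1 : walkInit.flatCost ≤ (u + l) * walkInit.flatCost :=
        Nat.le_mul_of_pos_left _ (by omega)
      have h2 : 1 + walkTest.cost ≤ (u + l) * (1 + walkTest.cost) :=
        Nat.le_mul_of_pos_left _ (by omega)
      have h3 : (u + (l - 1)) * (1 + walkTest.cost + walkStep.flatCost) ≤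
          (u + l) * (1 + walkTest.cost + walkStep.flatCost) :=
        Nat.mul_le_mul_right _ (by omega)
      calc _ ≤ (u + l) * walkInit.flatCost + ((u + l) * (1 + walkTest.cost + walkStep.flatCost) +
            (u + l) * (1 + walkTest.cost)) := by omega
        _ = _ := by ring
    · rintro s' ⟨⟨m, e16, -, -, e18, e19, -, ep, eq, ed, et⟩, hb⟩
      simp only [walkTest, Test.holds_disj, Test.Holds, NatExpr.eval, e16, not_or, not_lt] at hb
      refine ⟨ep, eq, fun i₀ hi j₀ hj hA hB => ?_⟩
      rcases et i₀ hi j₀ hj hA hB with ⟨h1, h2⟩ | h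
      · rwa [show s'.var 18 = i₀ by omega, show s'.var 19 = j₀ by omega] at ed
      · exact h
  · rintro m s' ⟨i16, i5, i6, i18, i19, im, ip, iq, id, it⟩ hb
    simp only [walkTest, Test.holds_disj, Test.Holds, NatExpr.eval, i16] at hb
    let adv : Prog := .cond (.conj (.natLt (.add (.var 18) (.const 1)) (.var 16))
      (.disj (.natEq (.var 19) (.const 0))
        (.realLt (.const 0) (.cross (.get 6 (.sub (.var 19) (.const 1))) (.get 6 (.var 19))
          (.get 5 (.var 18)) (.get 5 (.add (.var 18) (.const 1)))))))
      (.set 18 (.add (.var 18) (.const 1)))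
      (.set 19 (.sub (.var 19) (.const 1)))
    have hadv : adv.LoopFree := by simp [adv]
    obtain ⟨s₁, hs₁⟩ : ∃ s₁, s₁ = adv.run pt s' := ⟨_, rfl⟩
    have j16 : s₁.var 16 = u := by rw [hs₁, hadv.run_var (by simp [adv]), i16]
    have j20 : s₁.var 20 = s'.var 20 := by rw [hs₁, hadv.run_var (by simp [adv])]
    have j21 : s₁.var 21 = s'.var 21 := by rw [hs₁, hadv.run_var (by simp [adv])]
    have jarr : s₁.arr = s'.arr := by
      rw [hs₁]
      simp only [adv, Prog.run]
      split_ifs <;> rfl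
    have j5 : s₁.arr 5 = U := by rw [jarr, i5]
    have j6 : s₁.arr 6 = L := by rw [jarr, i6]
    obtain ⟨j18, j19, jm, jt⟩ : s₁.var 18 < u ∧ s₁.var 19 < l ∧
        (u - s₁.var 18) + s₁.var 19 < m ∧ ∀ i₀ < u, ∀ j₀ < l,
        (∀ i < i₀, 0 < j₀ → 0 < cross pt (L (j₀ - 1)) (L j₀) (U i) (U (i + 1))) →
        (∀ j, j₀ < j → j < l → i₀ + 1 < u →
          cross pt (L (j - 1)) (L j) (U i₀) (U (i₀ + 1)) ≤ 0) →
        (s₁.var 18 ≤ i₀ ∧ j₀ ≤ s₁.var 19) ∨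
          sqDist pt (U i₀) (L j₀) ≤ sqDist pt (s'.var 20) (s'.var 21) := by
      rw [hs₁]
      simp only [adv, Prog.run, Test.holds_disj, Test.Holds, NatExpr.eval, RealExpr.eval_cross,
        RealExpr.eval, i5, i6, i16, Int.cast_zero]
      split_ifs with hc
      · simp
        refine ⟨hc.1, i19, by omega, fun i₀ hi j₀ hj hA hB => ?_⟩
        rcases it i₀ hi j₀ hj hA hB with ⟨h1, h2⟩ | h
        · by_cases he : s'.var 18 = i₀
          · by_cases he' : s'.var 19 = j₀
            · right
              rwa [he, he'] at id
            · exfalso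
              rcases hc.2 with h0 | h0
              · omega
              · rw [he] at h0
                exact h0.not_ge (hB _ (by omega) i19 (by omega))
          · left; omega
        · exact .inr h
      · simp
        refine ⟨i18, by omega, by omega, fun i₀ hi j₀ hj hA hB => ?_⟩
        rcases it i₀ hi j₀ hj hA hB with ⟨h1, h2⟩ | h
        · by_cases he' : s'.var 19 = j₀
          · by_cases he : s'.var 18 = i₀
            · right
              rwa [he, he'] at id
            · exfalso
              refine hc ⟨by omega, ?_⟩
              rcases Nat.eq_zero_or_pos (s'.var 19) with h0 | h0
              · exact .inl h0
              · right
                rw [he'] at h0 ⊢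
                exact hA _ (by omega) h0
          · left; omega
        · exact .inr h
    refine Runs.of_loopFree (by simp [walkStep]) ⟨_, jm, ?_⟩
    have hrun : walkStep.run pt s' = (Prog.cond (.realLt (.sqDist (.var 20) (.var 21))
        (.sqDist (.get 5 (.var 18)) (.get 6 (.var 19))))
      (.seq (.set 20 (.get 5 (.var 18))) (.set 21 (.get 6 (.var 19)))) .skip).run pt s₁ := by
      rw [hs₁]; rfl
    rw [hrun]
    simp only [Prog.run, Test.Holds, RealExpr.eval_sqDist, NatExpr.eval, j5, j6]
    rw [← j20, ← j21] at jt
    split_ifs with hc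
    · simp [j16, j5, j6]
      refine ⟨j18, j19, ⟨_, j18, rfl⟩, ⟨_, j19, rfl⟩, fun i₀ hi j₀ hj hA hB => ?_⟩
      exact (jt i₀ hi j₀ hj hA hB).imp_right
        fun h => h.trans hc.le
    · refine ⟨j16, j5, j6, j18, j19, rfl, ?_, ?_, not_lt.1 hc, jt⟩
      · rwa [j20]
      · rwa [j21]
  · simp [walkInit, h16, h17, h5, h6]
    refine ⟨hu, hl, ⟨0, hu, rfl⟩, ⟨_, by omega, rfl⟩, fun i₀ hi j₀ hj _ _ => ?_⟩
    left; omega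

/-- The scalar product of the vector from `a` to `b` with the vector `(v, w)`. -/
noncomputable def dotStep (pt : ℕ → Plane) (v w : ℝ) (a b : ℕ) : ℝ :=
  (pt b 0 - pt a 0) * v + (pt b 1 - pt a 1) * w

section Geometry

variable {pt : ℕ → Plane} {v w : ℝ}

theorem dotStep_swap (a b : ℕ) : dotStep pt v w a b = -dotStep pt v w b a := by
  unfold dotStep; ring

theorem LexLT.sub {a b : ℕ} (h : LexLT pt a b) : 0 < pt b 0 - pt a 0 ∨
    pt b 0 - pt a 0 = 0 ∧ 0 < pt b 1 - pt a 1 := by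
  rcases h with h | ⟨h, h'⟩
  · exact .inl (sub_pos.2 h)
  · exact .inr ⟨by rw [h, sub_self], sub_pos.2 h'⟩

theorem LexLT.cross_pos (hv : 0 < w ∨ w = 0 ∧ 0 < v) {a b c d : ℕ} (hab : LexLT pt a b)
    (hcd : LexLT pt c d) (hn : dotStep pt v w a b < 0) (hp : 0 ≤ dotStep pt v w c d) :
    0 < cross pt a b c d :=
  cross_pos_of_dot hab.sub hcd.sub hv hn hp

theorem cross_swap (a b c d : ℕ) : cross pt a b c d = -cross pt c d a b := by
  unfold cross; ring

/-- Up to the vertex that is extreme in an upward direction, the edges of an upper chain ascend. -/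
theorem upperChain_dotStep_nonneg (hv : 0 < w ∨ w = 0 ∧ 0 < v) {U : ℕ → ℕ} {u i₀ : ℕ}
    (hlex : ∀ i j, i < j → j < u → LexLT pt (U i) (U j))
    (hturn : ∀ i, i + 2 < u → ¬ 0 ≤ cross pt (U i) (U (i + 1)) (U (i + 1)) (U (i + 2)))
    (hi₀ : i₀ < u) (hmax : ∀ i < u, i ≠ i₀ → dotStep pt v w (U i₀) (U i) < 0) :
    ∀ i < i₀, 0 ≤ dotStep pt v w (U i) (U (i + 1)) := by
  have key : ∀ d i, i + 1 + d = i₀ → 0 ≤ dotStep pt v w (U i) (U (i + 1)) := by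
    intro d
    induction d with
    | zero =>
      rintro i rfl
      rw [dotStep_swap]
      have := hmax i (by omega) (by omega)
      simp only [Nat.add_zero] at this
      linarith
    | succ d ih =>
      intro i hi
      by_contra hneg
      exact hturn i (by omega) (LexLT.cross_pos hv (hlex _ _ (by omega) (by omega))
        (hlex _ _ (by omega) (by omega)) (not_le.1 hneg) (ih (i + 1) (by omega))).le
  exact fun i hi => key (i₀ - (i + 1)) i (by omega)

/-- From the vertex that is extreme in a downward direction on, the edges of a lower chain
ascend. -/
theorem lowerChain_dotStep_nonneg (hv : 0 < w ∨ w = 0 ∧ 0 < v) {L : ℕ → ℕ} {l j₀ : ℕ}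
    (hlex : ∀ i j, i < j → j < l → LexLT pt (L i) (L j))
    (hturn : ∀ i, i + 2 < l → ¬ cross pt (L i) (L (i + 1)) (L (i + 1)) (L (i + 2)) ≤ 0)
    (hmin : ∀ j < l, j ≠ j₀ → 0 < dotStep pt v w (L j₀) (L j)) :
    ∀ j, j₀ < j → j < l → 0 ≤ dotStep pt v w (L (j - 1)) (L j) := by
  have key : ∀ d, j₀ + d + 1 < l → 0 ≤ dotStep pt v w (L (j₀ + d)) (L (j₀ + d + 1)) := by
    intro d
    induction d with
    | zero =>
      intro h
      exact (hmin _ h (by omega)).le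
    | succ d ih =>
      intro h
      by_contra hneg
      refine hturn (j₀ + d) (by omega) ?_
      rw [cross_swap, neg_nonpos]
      exact (LexLT.cross_pos hv (hlex _ _ (by omega) (by omega))
        (hlex _ _ (by omega) (by omega)) (not_le.1 hneg) (ih (by omega))).le
  intro j h h'
  have := key (j - 1 - j₀) (by omega)
  rwa [show j₀ + (j - 1 - j₀) = j - 1 by omega, show j - 1 + 1 = j by omega] at this

theorem dotStep_neg_of_farthest {a b r : ℕ} (hmax : sqDist pt a r ≤ sqDist pt a b)
    (hr : pt r ≠ pt b) : dotStep pt (pt b 0 - pt a 0) (pt b 1 - pt a 1) b r < 0 := by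
  have hpos : 0 < sqDist pt r b := by
    refine lt_of_le_of_ne (sqDist_nonneg ..) fun h => hr ?_
    unfold sqDist at h
    obtain ⟨h0, h1⟩ := mul_self_add_mul_self_eq_zero.1 h.symm
    ext i
    fin_cases i
    · exact sub_eq_zero.1 h0
    · exact sub_eq_zero.1 h1
  unfold sqDist at hmax hpos
  unfold dotStep
  nlinarith

end Geometry

/-- The middle of three points on an upper chain is not above the line through the others. -/
def UpperPop (pt : ℕ → Plane) (a b c : ℕ) : Prop := 0 ≤ cross pt a b b c

/-- The middle of three points on a lower chain is not below the line through the others. -/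
def LowerPop (pt : ℕ → Plane) (a b c : ℕ) : Prop := cross pt a b b c ≤ 0

theorem sqDist_le_of_antipodal {pt : ℕ → Plane} {inQ : ℕ → Prop} {X U L : ℕ → ℕ} {n u l : ℕ}
    (hX : ∀ x < n, X x < n) (hX' : ∀ v < n, ∃ x < n, X x = v)
    (hpt : ∀ a < n, ∀ b < n, pt a = pt b → a = b)
    (hU : HullState (LexLT pt) (UpperPop pt) inQ X n n u U)
    (hL : HullState (LexLT pt) (LowerPop pt) inQ X n n l L) {d : ℝ} (hd : 0 ≤ d)
    (h : ∀ i₀ < u, ∀ j₀ < l,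
        (∀ i < i₀, 0 < j₀ → 0 < cross pt (L (j₀ - 1)) (L j₀) (U i) (U (i + 1))) →
        (∀ j, j₀ < j → j < l → i₀ + 1 < u →
          cross pt (L (j - 1)) (L j) (U i₀) (U (i₀ + 1)) ≤ 0) →
        sqDist pt (U i₀) (L j₀) ≤ d) :
    ∀ a < n, ∀ b < n, inQ a → inQ b → sqDist pt a b ≤ d := by
  classical
  intro a₁ ha₁ b₁ hb₁ hqa₁ hqb₁
  let Q : Finset (ℕ × ℕ) := (Finset.range n ×ˢ Finset.range n).filter
    fun r => inQ r.1 ∧ inQ r.2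
  have hQ : ∀ a b, (a, b) ∈ Q ↔ (a < n ∧ b < n) ∧ inQ a ∧ inQ b := by simp [Q]
  obtain ⟨⟨a, b⟩, hab, hmax⟩ := Q.exists_max_image (fun r => sqDist pt r.1 r.2)
    ⟨(a₁, b₁), (hQ _ _).2 ⟨⟨ha₁, hb₁⟩, hqa₁, hqb₁⟩⟩
  refine (hmax (a₁, b₁) ((hQ _ _).2 ⟨⟨ha₁, hb₁⟩, hqa₁, hqb₁⟩)).trans ?_
  simp only
  replace hmax : ∀ r₁ < n, ∀ r₂ < n, inQ r₁ → inQ r₂ → sqDist pt r₁ r₂ ≤ sqDist pt a b :=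
    fun r₁ h₁ r₂ h₂ h₃ h₄ => hmax (r₁, r₂) ((hQ _ _).2 ⟨⟨h₁, h₂⟩, h₃, h₄⟩)
  obtain ⟨⟨ha, hb⟩, hqa, hqb⟩ := (hQ _ _).1 hab
  clear_value Q
  clear hQ hab Q ha₁ hb₁ hqa₁ hqb₁ a₁ b₁
  have main : ∀ a < n, ∀ b < n, inQ a → inQ b →
      (∀ r₁ < n, ∀ r₂ < n, inQ r₁ → inQ r₂ → sqDist pt r₁ r₂ ≤ sqDist pt a b) →
      (0 < pt b 1 - pt a 1 ∨ pt b 1 - pt a 1 = 0 ∧ 0 < pt b 0 - pt a 0) →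
      sqDist pt a b ≤ d := by
    intro a ha b hb hqa hqb hmax hv
    have memU : ∀ i < u, U i < n ∧ inQ (U i) := by
      intro i hi
      obtain ⟨x, hx, e, hq⟩ := hU.mem i hi
      exact e ▸ ⟨hX x hx, hq⟩
    have memL : ∀ i < l, L i < n ∧ inQ (L i) := by
      intro i hi
      obtain ⟨x, hx, e, hq⟩ := hL.mem i hi
      exact e ▸ ⟨hX x hx, hq⟩
    have hb' : ∀ r < n, inQ r → r ≠ b →
        dotStep pt (pt b 0 - pt a 0) (pt b 1 - pt a 1) b r < 0 := fun r hr hqr hne =>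
      dotStep_neg_of_farthest (hmax a ha r hr hqa hqr) fun h => hne (hpt r hr b hb h)
    have ha' : ∀ r < n, inQ r → r ≠ a →
        0 < dotStep pt (pt b 0 - pt a 0) (pt b 1 - pt a 1) a r := by
      intro r hr hqr hne
      have := dotStep_neg_of_farthest (a := b) (b := a) (r := r)
        (by rw [sqDist_comm pt b a]; exact hmax b hb r hr hqb hqr) fun h => hne (hpt r hr a ha h)
      unfold dotStep at this ⊢
      linarith
    generalize hgv : pt b 0 - pt a 0 = v at *
    generalize hgw : pt b 1 - pt a 1 = w at *
    have irr : ∀ r, ¬ LexLT pt r r := by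
      rintro r (h | h)
      · exact lt_irrefl _ h
      · exact lt_irrefl _ h.2
    obtain ⟨xa, hxa, rfl⟩ := hX' a ha
    obtain ⟨xb, hxb, rfl⟩ := hX' b hb
    obtain ⟨i₀, hi₀, ei⟩ := hU.protected_mem xb hxb hqb (by
      intro y z hy hz hqy hqz hyb hbz hpop
      have h1 := hb' _ (hX y hy) hqy fun e => irr _ (e ▸ hyb)
      have h2 := hb' _ (hX z hz) hqz fun e => irr _ (e ▸ hbz)
      rw [dotStep_swap] at h1
      have := LexLT.cross_pos hv hbz hyb h2 (by linarith)
      rw [cross_swap] at this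
      unfold UpperPop at hpop
      linarith)
    obtain ⟨j₀, hj₀, ej⟩ := hL.protected_mem xa hxa hqa (by
      intro y z hy hz hqy hqz hya haz hpop
      have h1 := ha' _ (hX y hy) hqy fun e => irr _ (e ▸ hya)
      have h2 := ha' _ (hX z hz) hqz fun e => irr _ (e ▸ haz)
      rw [dotStep_swap] at h1
      have := LexLT.cross_pos hv hya haz (by linarith) h2.le
      unfold LowerPop at hpop
      linarith)
    have hneU : ∀ i < u, i ≠ i₀ → U i ≠ X xb := by
      intro i hi hne e
      rcases lt_or_gt_of_ne hne with h | h
      · have := hU.sorted _ _ h hi₀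
        rw [e, ei] at this
        exact irr _ this
      · have := hU.sorted _ _ h hi
        rw [e, ei] at this
        exact irr _ this
    have hneL : ∀ i < l, i ≠ j₀ → L i ≠ X xa := by
      intro i hi hne e
      rcases lt_or_gt_of_ne hne with h | h
      · have := hL.sorted _ _ h hj₀
        rw [e, ej] at this
        exact irr _ this
      · have := hL.sorted _ _ h hi
        rw [e, ej] at this
        exact irr _ this
    have dU : ∀ i < u, i ≠ i₀ → dotStep pt v w (U i₀) (U i) < 0 := fun i hi hne => by
      rw [ei]
      exact hb' _ (memU i hi).1 (memU i hi).2 (hneU i hi hne)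
    have dL : ∀ i < l, i ≠ j₀ → 0 < dotStep pt v w (L j₀) (L i) := fun i hi hne => by
      rw [ej]
      exact ha' _ (memL i hi).1 (memL i hi).2 (hneL i hi hne)
    have upU := upperChain_dotStep_nonneg hv hU.sorted hU.noPop hi₀ dU
    have upL := lowerChain_dotStep_nonneg hv hL.sorted hL.noPop dL
    rw [sqDist_comm, ← ei, ← ej]
    refine h i₀ hi₀ j₀ hj₀ (fun i hi hj => ?_) fun j hj hjl hi => ?_
    · refine LexLT.cross_pos hv (hL.sorted _ _ (by omega) hj₀) (hU.sorted _ _ (by omega)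
        (by omega)) ?_ (upU i hi)
      rw [dotStep_swap]
      have := dL (j₀ - 1) (by omega) (by omega)
      linarith
    · rw [cross_swap, neg_nonpos]
      exact (LexLT.cross_pos hv (hU.sorted _ _ (by omega) hi) (hL.sorted _ _ (by omega) hjl)
        (dU _ hi (by omega)) (upL j hj hjl)).le
  rcases lt_trichotomy (pt b 1 - pt a 1) 0 with hw | hw | hw
  · rw [sqDist_comm] at hmax ⊢
    exact main b hb a ha hqb hqa hmax (.inl (by linarith))
  · rcases lt_trichotomy (pt b 0 - pt a 0) 0 with hv | hv | hv
    · rw [sqDist_comm] at hmax ⊢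
      exact main b hb a ha hqb hqa hmax (.inr ⟨by linarith, by linarith⟩)
    · refine le_trans (le_of_eq ?_) hd
      unfold sqDist
      rw [sub_eq_zero.1 hw, sub_eq_zero.1 hv]
      ring
    · exact main a ha b hb hqa hqb hmax (.inr ⟨hw, hv⟩)
  · exact main a ha b hb hqa hqb hmax (.inl hw)

def crossTop (a u : ℕ) : RealExpr :=
  .cross (.get a (.sub (.var u) (.const 2))) (.get a (.sub (.var u) (.const 1)))
    (.get a (.sub (.var u) (.const 1))) (.get 2 (.var 14))

/-- The farthest pair among the elements of array `2` that do not satisfy `F`. -/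
def farthestPair (F : Test) : Prog :=
  .seq (hullLoop F (.neg (.realLt (crossTop 5 16) (.const 0))) 5 16)
    (.seq (hullLoop F (.neg (.realLt (.const 0) (crossTop 6 17))) 6 17) walk)

theorem farthestPair_keepsVar {F : Test} {x : ℕ} (h : x < 14 ∨ 22 ≤ x) :
    (farthestPair F).KeepsVar x := by
  simp [farthestPair, hullLoop, hullStep, walk, walkInit, walkStep]
  omega

theorem farthestPair_keepsArr {F : Test} {a : ℕ} (h : a < 5) : (farthestPair F).KeepsArr a := by
  simp [farthestPair, hullLoop, hullStep, walk, walkInit, walkStep]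
  omega

theorem farthestPair_spec (F : Test) : ∃ C, ∀ (pt : ℕ → Plane) (inQ : ℕ → Prop) (X : ℕ → ℕ)
    (n : ℕ) (s : Store),
    (∀ s' : Store, (∀ x, x = 13 ∨ 30 ≤ x → s'.var x = s.var x) →
      (F.Holds pt s' ↔ ¬ inQ (s'.arr 2 (s'.var 14)))) →
    s.var 0 = n → s.arr 2 = X → (∀ x y, x < y → y < n → LexLT pt (X x) (X y)) →
    (∀ x < n, X x < n) → (∀ v < n, ∃ x < n, X x = v) →
    (∀ a < n, ∀ b < n, pt a = pt b → a = b) → (∃ a < n, inQ a) →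
    Runs pt (farthestPair F) s ((n + 1) * C) fun s' =>
      s'.var 20 < n ∧ s'.var 21 < n ∧ inQ (s'.var 20) ∧ inQ (s'.var 21) ∧
      ∀ a < n, ∀ b < n, inQ a → inQ b → sqDist pt a b ≤ sqDist pt (s'.var 20) (s'.var 21) := by
  obtain ⟨C₁, h₁⟩ := hullLoop_spec F (.neg (.realLt (crossTop 5 16) (.const 0))) (a := 5)
    (u := 16) (by simp) (by simp) (by simp) (by simp) (by simp)
  obtain ⟨C₂, h₂⟩ := hullLoop_spec F (.neg (.realLt (.const 0) (crossTop 6 17))) (a := 6)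
    (u := 17) (by simp) (by simp) (by simp) (by simp) (by simp)
  obtain ⟨C₃, h₃⟩ := walk_spec
  refine ⟨C₁ + C₂ + 2 * C₃, fun pt inQ X n s hF h0 h2 hlex hX hX' hpt ⟨z, hz, hqz⟩ => ?_⟩
  have hT : (n + 1) * C₁ + ((n + 1) * C₂ + (n + n) * C₃) ≤ (n + 1) * (C₁ + C₂ + 2 * C₃) := by
    ring_nf; omega
  obtain ⟨xz, hxz, rfl⟩ := hX' z hz
  refine Runs.mono (Runs.seq ((h₁ pt (LexLT pt) (UpperPop pt) inQ X n s hF ?_ h0 h2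
    hlex).frame.mono le_rfl ?_)) hT fun _ h => h
  · intro s'
    simp [crossTop, UpperPop]
  rintro s₁ ⟨hU, f1, f2⟩
  have k1 : ∀ x, x < 14 ∨ 18 ≤ x → s₁.var x = s.var x := fun x hx =>
    f1 x (by simp [hullLoop, hullStep]; omega)
  have k2 : s₁.arr 2 = X := (f2 2 (by simp [hullLoop, hullStep])).trans h2
  refine Runs.seq ((h₂ pt (LexLT pt) (LowerPop pt) inQ X n s₁ (fun s' hs' => hF s' fun x hx =>
    (hs' x hx).trans (k1 x (by omega))) ?_ ((k1 0 (by simp)).trans h0) k2 hlex).frame.mono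
    le_rfl ?_)
  · intro s'
    simp [crossTop, LowerPop]
  rintro s₂ ⟨hL, g1, g2⟩
  have e16 : s₂.var 16 = s₁.var 16 := g1 16 (by simp [hullLoop, hullStep])
  have e5 : s₂.arr 5 = s₁.arr 5 := g2 5 (by simp [hullLoop, hullStep])
  refine (h₃ pt s₂ _ _ _ _ e16 rfl e5 rfl (hU.pos xz hxz hqz) (hL.pos xz hxz hqz)).mono
    (Nat.mul_le_mul_right _ (Nat.add_le_add hU.height hL.height)) ?_
  rintro s₃ ⟨⟨i, hi, ei⟩, ⟨j, hj, ej⟩, hw⟩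
  obtain ⟨x, hx, ex, hqx⟩ := hU.mem i hi
  obtain ⟨y, hy, ey, hqy⟩ := hL.mem j hj
  refine ⟨?_, ?_, ?_, ?_, sqDist_le_of_antipodal hX hX' hpt hU hL (sqDist_nonneg ..) hw⟩
  · rw [ei, ex]; exact hX x hx
  · rw [ej, ey]; exact hX y hy
  · rwa [ei, ex]
  · rwa [ej, ey]

/-! ### Comparing minimum distances -/

/-- The minimum of a list of reals; `⊤` for the empty list. -/
noncomputable def minOf : List ℝ → WithTop ℝ
  | [] => ⊤
  | a :: l => min (a : WithTop ℝ) (minOf l)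

theorem minOf_append (l l' : List ℝ) : minOf (l ++ l') = min (minOf l) (minOf l') := by
  induction l with
  | nil => simp [minOf]
  | cons a l ih => simp [minOf, ih, min_assoc]

theorem coe_lt_minOf {r : ℝ} {l : List ℝ} : (r : WithTop ℝ) < minOf l ↔ ∀ b ∈ l, r < b := by
  induction l with
  | nil => simp [minOf]
  | cons a l ih => simp [minOf, ih]

theorem minOf_lt {l : List ℝ} {y : WithTop ℝ} : minOf l < y ↔ ∃ a ∈ l, (a : WithTop ℝ) < y := by
  induction l with
  | nil => simp [minOf]
  | cons a l ih => simp [minOf, ih]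

theorem coe_le_minOf {r : ℝ} {l : List ℝ} : (r : WithTop ℝ) ≤ minOf l ↔ ∀ b ∈ l, r ≤ b := by
  induction l with
  | nil => simp [minOf]
  | cons a l ih => simp [minOf, ih]

def Test.any (l : List Test) : Test := l.foldr Test.disj (.natLt (.const 0) (.const 0))

def Test.all (l : List Test) : Test := l.foldr Test.conj (.natEq (.const 0) (.const 0))

@[simp] theorem Test.holds_any (pt : ℕ → Plane) (s : Store) (l : List Test) :
    (Test.any l).Holds pt s ↔ ∃ b ∈ l, b.Holds pt s := by
  induction l with
  | nil => simp [Test.any]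
  | cons b l ih =>
    rw [Test.any] at ih
    simp [Test.any, ih]

@[simp] theorem Test.holds_all (pt : ℕ → Plane) (s : Store) (l : List Test) :
    (Test.all l).Holds pt s ↔ ∀ b ∈ l, b.Holds pt s := by
  induction l with
  | nil => simp [Test.all]
  | cons b l ih =>
    rw [Test.all] at ih
    simp [Test.all, ih]

/-- The minimum of the first list is less than the minimum of the second list. -/
def Test.minLt (l l' : List RealExpr) : Test :=
  .any (l.map fun e => .all (l'.map fun f => .realLt e f))

theorem Test.holds_minLt (pt : ℕ → Plane) (s : Store) (l l' : List RealExpr) :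
    (Test.minLt l l').Holds pt s ↔
      minOf (l.map (RealExpr.eval pt s)) < minOf (l'.map (RealExpr.eval pt s)) := by
  simp [Test.minLt, minOf_lt, coe_lt_minOf]

/-- The pairs of elements at different positions of a list. -/
def List.pairs {α : Type*} : List α → List (α × α)
  | [] => []
  | a :: l => l.map (fun b => (a, b)) ++ l.pairs

theorem List.pairs_map {α β : Type*} (f : α → β) (l : List α) :
    (l.map f).pairs = l.pairs.map fun r => (f r.1, f r.2) := by
  induction l with
  | nil => rfl
  | cons a l ih => simp [List.pairs, ih]

/-- The minimum squared distance of two points at different positions of a list. -/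
noncomputable def minSep (pt : ℕ → Plane) (l : List ℕ) : WithTop ℝ :=
  minOf (l.pairs.map fun r => sqDist pt r.1 r.2)

/-- The minimum squared distance of a point to the points of a list. -/
noncomputable def distTo (pt : ℕ → Plane) (S : List ℕ) (a : ℕ) : WithTop ℝ :=
  minOf (S.map (sqDist pt a))

def RealExpr.sep (l : List NatExpr) : List RealExpr := l.pairs.map fun r => .sqDist r.1 r.2

def RealExpr.distTo (S : List NatExpr) (a : NatExpr) : List RealExpr := S.map (.sqDist a)

theorem RealExpr.minOf_sep (pt : ℕ → Plane) (s : Store) (l : List NatExpr) :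
    minOf ((RealExpr.sep l).map (RealExpr.eval pt s)) =
      minSep pt (l.map (NatExpr.eval s)) := by
  simp [minSep, List.pairs_map, RealExpr.sep, Function.comp_def]

theorem RealExpr.minOf_distTo (pt : ℕ → Plane) (s : Store) (S : List NatExpr) (a : NatExpr) :
    minOf ((RealExpr.distTo S a).map (RealExpr.eval pt s)) =
      _root_.distTo pt (S.map (NatExpr.eval s)) (a.eval s) := by
  simp [_root_.distTo, RealExpr.distTo, Function.comp_def]

theorem minSep_cons_cons (pt : ℕ → Plane) (a b : ℕ) (S : List ℕ) :
    minSep pt (a :: b :: S) = min (min (sqDist pt a b : WithTop ℝ) (distTo pt S a))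
      (min (distTo pt S b) (minSep pt S)) := by
  simp [minSep, List.pairs, minOf, minOf_append, distTo, Function.comp_def, min_assoc]

/-! ### The best extension of a tuple by a pair -/

/-- The tuple stored in the variables from `30` on. -/
def tupleExpr (m : ℕ) : List NatExpr := (List.range m).map fun i => .var (30 + i)

def tupleOf (m : ℕ) (f : ℕ → ℕ) : List ℕ := (List.range m).map f

def bestExpr (m : ℕ) : List NatExpr := (List.range (m + 2)).map fun i => .get 0 (.const i)

/-- The value of the recorded solution. -/
noncomputable def bestSep (pt : ℕ → Plane) (m : ℕ) (s : Store) : WithTop ℝ :=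
  minSep pt (tupleOf (m + 2) (s.arr 0))

@[simp] theorem eval_tupleExpr (m : ℕ) (s : Store) :
    (tupleExpr m).map (NatExpr.eval s) = tupleOf m fun i => s.var (30 + i) := by
  simp [tupleExpr, tupleOf, Function.comp_def]

@[simp] theorem eval_bestExpr (m : ℕ) (s : Store) :
    (bestExpr m).map (NatExpr.eval s) = tupleOf (m + 2) (s.arr 0) := by
  simp [bestExpr, tupleOf, Function.comp_def]

def writeTuple : ℕ → Prog
  | 0 => .seq (.put 0 (.const 0) (.var 20)) (.put 0 (.const 1) (.var 21))
  | m + 1 => .seq (writeTuple m) (.put 0 (.const (m + 2)) (.var (30 + m)))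

theorem writeTuple_loopFree (m : ℕ) : (writeTuple m).LoopFree := by
  induction m with
  | zero => simp [writeTuple]
  | succ m ih => simp [writeTuple, ih]

theorem writeTuple_keepsVar (m x : ℕ) : (writeTuple m).KeepsVar x := by
  induction m with
  | zero => simp [writeTuple]
  | succ m ih => simp [writeTuple, ih]

theorem writeTuple_keepsArr (m : ℕ) {a : ℕ} (ha : a ≠ 0) : (writeTuple m).KeepsArr a := by
  induction m with
  | zero => simp [writeTuple, ha]
  | succ m ih => simp [writeTuple, ih, ha]

theorem tupleOf_succ (m : ℕ) (f : ℕ → ℕ) : tupleOf (m + 1) f = tupleOf m f ++ [f m] := by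
  simp [tupleOf, List.range_succ]

theorem tupleOf_congr {m : ℕ} {f g : ℕ → ℕ} (h : ∀ i < m, f i = g i) :
    tupleOf m f = tupleOf m g :=
  List.map_congr_left fun i hi => h i (List.mem_range.1 hi)

theorem writeTuple_run (pt : ℕ → Plane) (m : ℕ) (s : Store) :
    tupleOf (m + 2) (((writeTuple m).run pt s).arr 0) =
      s.var 20 :: s.var 21 :: tupleOf m fun i => s.var (30 + i) := by
  induction m with
  | zero => simp [writeTuple, tupleOf, List.range_succ]
  | succ m ih =>
    rw [tupleOf_succ m, ← List.cons_append, ← List.cons_append, ← ih, tupleOf_succ (m + 2)]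
    simp only [writeTuple, Prog.run, NatExpr.eval, Store.put_arr, if_true, Function.update_self,
      (writeTuple_loopFree m).run_var (writeTuple_keepsVar m _)]
    congr 1
    exact tupleOf_congr fun i hi => by rw [Function.update_of_ne (by omega)]

/-- Record the tuple together with the variables `20` and `21` if this improves the solution. -/
def record (m : ℕ) : Prog :=
  .cond (.minLt (RealExpr.sep (bestExpr m))
    (RealExpr.sep (.var 20 :: .var 21 :: tupleExpr m))) (writeTuple m) .skip

theorem record_loopFree (m : ℕ) : (record m).LoopFree := by
  simp [record, writeTuple_loopFree]

theorem record_keepsVar (m x : ℕ) : (record m).KeepsVar x := by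
  simp [record, writeTuple_keepsVar]

theorem record_keepsArr (m : ℕ) {a : ℕ} (ha : a ≠ 0) : (record m).KeepsArr a := by
  simp [record, writeTuple_keepsArr m ha]

theorem record_spec (pt : ℕ → Plane) (m : ℕ) (s : Store) :
    Runs pt (record m) s (record m).flatCost fun s' =>
      bestSep pt m s ≤ bestSep pt m s' ∧
      minSep pt (s.var 20 :: s.var 21 :: tupleOf m fun i => s.var (30 + i)) ≤ bestSep pt m s' ∧
      ∀ a ∈ tupleOf (m + 2) (s'.arr 0), a ∈ tupleOf (m + 2) (s.arr 0) ∨ a = s.var 20 ∨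
        a = s.var 21 ∨ a ∈ tupleOf m fun i => s.var (30 + i) := by
  refine Runs.of_loopFree (record_loopFree m) ?_
  by_cases hc : (Test.minLt (RealExpr.sep (bestExpr m))
    (RealExpr.sep (.var 20 :: .var 21 :: tupleExpr m))).Holds pt s
  · rw [record, Prog.run_cond_pos hc, bestSep, bestSep, writeTuple_run]
    rw [Test.holds_minLt, RealExpr.minOf_sep, RealExpr.minOf_sep] at hc
    simp only [eval_bestExpr, List.map_cons, eval_tupleExpr, NatExpr.eval] at hc
    refine ⟨hc.le, le_rfl, fun a ha => ?_⟩
    right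
    simpa using ha
  · rw [record, Prog.run_cond_neg hc]
    rw [Test.holds_minLt, RealExpr.minOf_sep, RealExpr.minOf_sep] at hc
    simp only [eval_bestExpr, List.map_cons, eval_tupleExpr, NatExpr.eval, not_lt] at hc
    exact ⟨le_rfl, hc, fun a ha => .inl ha⟩

/-- The tables for halves and for the lexicographic order are set up, and the recorded solution
consists of valid indices. -/
structure Ready (pt : ℕ → Plane) (n m : ℕ) (s : Store) : Prop where
  size : s.var 0 = n
  half : ∀ d ≤ n, s.arr 1 d = d / 2
  sorted : ∀ x y, x < y → y < n → LexLT pt (s.arr 2 x) (s.arr 2 y)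
  lt : ∀ x < n, s.arr 2 x < n
  surj : ∀ v < n, ∃ x < n, s.arr 2 x = v
  best : ∀ a ∈ tupleOf (m + 2) (s.arr 0), a < n

/-- `X[t]` is closer to the tuple than variable `13`. -/
def closer (m : ℕ) : Test :=
  .minLt (RealExpr.distTo (tupleExpr m) (.get 2 (.var 14)))
    (RealExpr.distTo (tupleExpr m) (.var 13))

def searchSetup : Prog :=
  .seq (.set 12 (.add (.var 10) (.get 1 (.sub (.var 11) (.var 10))))) (.set 13 (.get 3 (.var 12)))

def searchStep (m : ℕ) : Prog :=
  .cond (.minLt [.sqDist (.var 20) (.var 21)] (RealExpr.distTo (tupleExpr m) (.var 13)))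
    (.set 10 (.add (.var 12) (.const 1))) (.set 11 (.var 12))

def searchInit : Prog := .seq (.set 10 (.const 0)) (.set 11 (.var 0))

def search (m : ℕ) : Prog :=
  .seq searchInit (.loop (.natLt (.var 10) (.var 11))
    (.seq searchSetup (.seq (farthestPair (closer m)) (.seq (record m) (searchStep m)))))

theorem search_keepsVar {m x : ℕ} (h : x < 10 ∨ 22 ≤ x) : (search m).KeepsVar x := by
  have h1 := farthestPair_keepsVar (F := closer m) (x := x) (by omega)
  simp [search, searchInit, searchSetup, searchStep, h1, record_keepsVar]
  omega

theorem Ready.congr {pt : ℕ → Plane} {n m : ℕ} {s s' : Store} (h : Ready pt n m s)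
    (h0 : s'.var 0 = s.var 0) (h1 : s'.arr 1 = s.arr 1) (h2 : s'.arr 2 = s.arr 2)
    (h3 : ∀ a ∈ tupleOf (m + 2) (s'.arr 0), a < n) : Ready pt n m s' where
  size := h0.trans h.size
  half := h1 ▸ h.half
  sorted := h2 ▸ h.sorted
  lt := h2 ▸ h.lt
  surj := h2 ▸ h.surj
  best := h3

/-- With `c` in order of decreasing distance from `S`, the pairs whose smaller distance
from `S` is that of a cell of `c` outside `[lo, hi)` have been taken into account. -/
def Covered (pt : ℕ → Plane) (S : List ℕ) (c : ℕ → ℕ) (n lo hi : ℕ) (best : WithTop ℝ) : Prop :=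
  ∀ a < n, ∀ b < n, ∀ j < n, distTo pt S (c j) = min (distTo pt S a) (distTo pt S b) →
    j < lo ∨ hi ≤ j → minSep pt (a :: b :: S) ≤ best

theorem search_spec (m : ℕ) : ∃ C, ∀ (pt : ℕ → Plane) (n : ℕ) (S : List ℕ) (s : Store),
    Ready pt n m s → (∀ a < n, ∀ b < n, pt a = pt b → a = b) →
    (tupleOf m fun i => s.var (30 + i)) = S → (∀ a ∈ S, a < n) →
    (∀ x y, x < y → y < n → distTo pt S (s.arr 3 y) ≤ distTo pt S (s.arr 3 x)) →
    (∀ x < n, s.arr 3 x < n) → (∀ v < n, ∃ x < n, s.arr 3 x = v) →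
    Runs pt (search m) s ((n + 1) * (Nat.log 2 n + 2) * C) fun s' =>
      Ready pt n m s' ∧ bestSep pt m s ≤ bestSep pt m s' ∧
      ∀ a < n, ∀ b < n, minSep pt (a :: b :: S) ≤ bestSep pt m s' := by
  obtain ⟨C₁, h₁⟩ := farthestPair_spec (closer m)
  let b : Test := .natLt (.var 10) (.var 11)
  let R := searchSetup.flatCost + ((record m).flatCost + (searchStep m).flatCost)
  refine ⟨searchInit.flatCost + (1 + b.cost + (R + C₁)),
    fun pt n S s hs hpt hS hSn hc hcn hcs => ?_⟩
  have hloop := Runs.loop_fuel (pt := pt) (b := b)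
    (p := .seq searchSetup (.seq (farthestPair (closer m)) (.seq (record m) (searchStep m))))
    (T := searchSetup.flatCost + ((n + 1) * C₁ + ((record m).flatCost + (searchStep m).flatCost)))
    (Inv := fun l s' => Ready pt n m s' ∧ (tupleOf m fun i => s'.var (30 + i)) = S ∧
      s'.arr 3 = s.arr 3 ∧ bestSep pt m s ≤ bestSep pt m s' ∧ s'.var 11 ≤ n ∧
      s'.var 11 < s'.var 10 + 2 ^ l ∧
      Covered pt S (s.arr 3) n (s'.var 10) (s'.var 11) (bestSep pt m s'))
    ?_ (Nat.log 2 n + 1) (searchInit.run pt s) ?_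
  · refine (Runs.seq_loopFree (by simp [searchInit]) hloop).mono ?_ ?_
    · have hR : searchSetup.flatCost +
        ((n + 1) * C₁ + ((record m).flatCost + (searchStep m).flatCost)) = R + (n + 1) * C₁ := by
        simp only [R]; omega
      rw [hR]
      generalize Nat.log 2 n = l
      generalize searchInit.flatCost = i
      generalize b.cost = b'
      have e1 : 1 + b' + (R + (n + 1) * C₁) ≤ (n + 1) * (1 + b' + (R + C₁)) := by
        rw [Nat.mul_add (n + 1) (1 + b'), Nat.mul_add (n + 1) R]
        have := Nat.le_mul_of_pos_left (1 + b') (Nat.succ_pos n)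
        have := Nat.le_mul_of_pos_left R (Nat.succ_pos n)
        simp only [Nat.succ_eq_add_one] at *
        omega
      have e2 := Nat.mul_le_mul_left (l + 1) e1
      have e3 : i ≤ (n + 1) * (l + 2) * i := Nat.le_mul_of_pos_left _ (by positivity)
      calc _ ≤ (n + 1) * (l + 2) * i + ((l + 1) * ((n + 1) * (1 + b' + (R + C₁))) +
            (n + 1) * (1 + b' + (R + C₁))) := by omega
        _ = _ := by ring
    · rintro s' ⟨⟨l, e0, -, -, e1, e2, -, e3⟩, hb⟩
      simp only [b, Test.Holds, NatExpr.eval, not_lt] at hb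
      refine ⟨e0, e1, fun x hx y hy => ?_⟩
      rcases min_choice (distTo pt S x) (distTo pt S y) with h | h
      · obtain ⟨j, hj, ej⟩ := hcs x hx
        exact e3 x hx y hy j hj (by rw [h, ej]) (by omega)
      · obtain ⟨j, hj, ej⟩ := hcs y hy
        exact e3 x hx y hy j hj (by rw [h, ej]) (by omega)
  · rintro l s' ⟨i0, iS, i3, ib, i11, il, ic⟩ hb
    simp only [b, Test.Holds, NatExpr.eval] at hb
    obtain ⟨lo, hlo⟩ : ∃ lo, s'.var 10 = lo := ⟨_, rfl⟩
    obtain ⟨hi, hhi⟩ : ∃ hi, s'.var 11 = hi := ⟨_, rfl⟩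
    rw [hlo, hhi] at ic il hb
    rw [hhi] at i11
    obtain ⟨mid, hmid⟩ : ∃ mid, mid = lo + (hi - lo) / 2 := ⟨_, rfl⟩
    obtain ⟨z, hz⟩ : ∃ z, z = s.arr 3 mid := ⟨_, rfl⟩
    have hmidn : mid < n := by omega
    have hl : ∃ l', l = l' + 1 := by
      rcases l with _ | l
      · simp at il; omega
      · exact ⟨l, rfl⟩
    obtain ⟨l', rfl⟩ := hl
    rw [pow_succ] at il
    obtain ⟨s₁, hs₁⟩ : ∃ s₁, s₁ = searchSetup.run pt s' := ⟨_, rfl⟩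
    have hk : ∀ x, x ≠ 12 → x ≠ 13 → s₁.var x = s'.var x := fun x h h' =>
      hs₁ ▸ Prog.LoopFree.run_var (by simp [searchSetup]) (by simp [searchSetup, h, h'])
    have ka : s₁.arr = s'.arr := by simp [hs₁, searchSetup]
    have k12 : s₁.var 12 = mid := by
      simp [hs₁, searchSetup, hlo, hhi, hmid, i0.half (hi - lo) (by omega)]
    have k13 : s₁.var 13 = z := by
      simp [hs₁, searchSetup, hlo, hhi, i0.half (hi - lo) (by omega), ← hmid, i3, hz]
    have kR : Ready pt n m s₁ := i0.congr (hk 0 (by simp) (by simp)) (by rw [ka]) (by rw [ka])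
      (by rw [ka]; exact i0.best)
    have kS : (tupleOf m fun i => s₁.var (30 + i)) = S := by
      rw [← iS]; exact tupleOf_congr fun i _ => hk _ (by omega) (by omega)
    have kb : bestSep pt m s₁ = bestSep pt m s' := by unfold bestSep; rw [ka]
    refine Runs.seq_loopFree (by simp [searchSetup]) (hs₁ ▸ Runs.seq ((h₁ pt
      (fun a => ¬ distTo pt S a < distTo pt S z) (s₁.arr 2) n s₁ ?_ kR.size rfl kR.sorted kR.lt
      kR.surj hpt ⟨z, hz ▸ hcn mid hmidn, lt_irrefl _⟩).frame.mono le_rfl ?_))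
    · intro s₂ h₂
      have e : (tupleOf m fun i => s₂.var (30 + i)) = S := by
        rw [← kS]; exact tupleOf_congr fun i _ => h₂ _ (by omega)
      rw [closer, Test.holds_minLt, RealExpr.minOf_distTo, RealExpr.minOf_distTo, not_not,
        eval_tupleExpr, e]
      simp only [NatExpr.eval]
      rw [h₂ 13 (by simp), k13]
    · rintro s₂ ⟨⟨p1, p2, p3, p4, p5⟩, f1, f2⟩
      have q1 : ∀ x, x < 14 ∨ 22 ≤ x → s₂.var x = s₁.var x := fun x hx =>
        f1 x (farthestPair_keepsVar hx)
      have q2 : ∀ a, a < 5 → s₂.arr a = s₁.arr a := fun a ha => f2 a (farthestPair_keepsArr ha)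
      have qS : (tupleOf m fun i => s₂.var (30 + i)) = S := by
        rw [← kS]; exact tupleOf_congr fun i _ => q1 _ (by omega)
      have qb : bestSep pt m s₂ = bestSep pt m s' := by
        rw [← kb]; unfold bestSep; rw [q2 0 (by simp)]
      refine Runs.seq ((record_spec pt m s₂).frame.mono le_rfl ?_)
      rintro s₃ ⟨⟨r1, r2, r3⟩, g1, g2⟩
      have t1 : ∀ x, s₃.var x = s₂.var x := fun x => g1 x (record_keepsVar m x)
      have t2 : ∀ a, a ≠ 0 → s₃.arr a = s₂.arr a := fun a ha => g2 a (record_keepsArr m ha)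
      rw [qS] at r2 r3
      rw [qb] at r1
      have tS : (tupleOf m fun i => s₃.var (30 + i)) = S := by
        rw [← qS]; exact tupleOf_congr fun i _ => t1 _
      have tR : Ready pt n m s₃ := by
        refine kR.congr ((t1 0).trans (q1 0 (by simp))) ((t2 1 (by simp)).trans (q2 1 (by simp)))
          ((t2 2 (by simp)).trans (q2 2 (by simp))) fun a ha => ?_
        rcases r3 a ha with h | rfl | rfl | h
        · rw [q2 0 (by simp)] at h
          exact kR.best a h
        · exact p1
        · exact p2
        · exact hSn a h
      have t3 : s₃.arr 3 = s.arr 3 := by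
        rw [t2 3 (by simp), q2 3 (by simp), ka, i3]
      have t10 : s₃.var 10 = lo := by
        rw [t1, q1 10 (by simp), hk 10 (by simp) (by simp), hlo]
      have t11 : s₃.var 11 = hi := by
        rw [t1, q1 11 (by simp), hk 11 (by simp) (by simp), hhi]
      have t12 : s₃.var 12 = mid := by
        rw [t1, q1 12 (by simp), k12]
      have t13 : s₃.var 13 = z := by
        rw [t1, q1 13 (by simp), k13]
      rw [← t1 20, ← t1 21, minSep_cons_cons] at r2
      rw [← t1 20] at p3 p5
      rw [← t1 21] at p4 p5
      have mono : ∀ x y, x ≤ y → y < n → distTo pt S (s.arr 3 y) ≤ distTo pt S (s.arr 3 x) := by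
        intro x y hxy hy
        rcases hxy.eq_or_lt with rfl | h
        · exact le_rfl
        · exact hc x y h hy
      have hcond : (Test.minLt [.sqDist (.var 20) (.var 21)]
          (RealExpr.distTo (tupleExpr m) (.var 13))).Holds pt s₃ ↔
          (sqDist pt (s₃.var 20) (s₃.var 21) : WithTop ℝ) < distTo pt S z := by
        rw [Test.holds_minLt, RealExpr.minOf_distTo, eval_tupleExpr, tS]
        simp [minOf, t13]
      have lift : min (min (sqDist pt (s₃.var 20) (s₃.var 21) : WithTop ℝ) (distTo pt S z))
          (minSep pt S) ≤ bestSep pt m s₃ := by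
        refine le_trans ?_ r2
        refine le_min (le_min ?_ ?_) (le_min ?_ (min_le_right _ _))
        · exact (min_le_left _ _).trans (min_le_left _ _)
        · exact ((min_le_left _ _).trans (min_le_right _ _)).trans (not_lt.1 p3)
        · exact ((min_le_left _ _).trans (min_le_right _ _)).trans (not_lt.1 p4)
      refine Runs.of_loopFree (by simp [searchStep]) ⟨l', by omega, ?_⟩
      by_cases hcmp : (sqDist pt (s₃.var 20) (s₃.var 21) : WithTop ℝ) < distTo pt S z
      · rw [searchStep, Prog.run_cond_pos (hcond.2 hcmp)]
        refine ⟨tR.congr (by simp) rfl rfl tR.best, ?_, t3, ib.trans r1, ?_, ?_, ?_⟩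
        · rw [← tS]; exact tupleOf_congr fun i _ => by simp; omega
        · simpa [t11] using i11
        · simp [t11, t12]
          omega
        · intro x hx y hy j hj he hjj
          simp [t11, t12] at hjj
          by_cases hj' : j ≤ mid
          · have hw : distTo pt S z ≤ min (distTo pt S x) (distTo pt S y) := by
              rw [← he, hz]; exact mono _ _ hj' hmidn
            refine le_trans ?_ lift
            rw [min_eq_left hcmp.le, minSep_cons_cons]
            refine le_min (((min_le_left _ _).trans (min_le_left _ _)).trans
              (WithTop.coe_le_coe.2 ?_)) ((min_le_right _ _).trans (min_le_right _ _))
            exact p5 x hx y hy (not_lt.2 (hw.trans (min_le_left _ _)))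
              (not_lt.2 (hw.trans (min_le_right _ _)))
          · exact (ic x hx y hy j hj he (by omega)).trans r1
      · rw [searchStep, Prog.run_cond_neg (fun h => hcmp (hcond.1 h))]
        refine ⟨tR.congr (by simp) rfl rfl tR.best, ?_, t3, ib.trans r1, ?_, ?_, ?_⟩
        · rw [← tS]; exact tupleOf_congr fun i _ => by simp; omega
        · simp [t12]; omega
        · simp [t10, t12]
          omega
        · intro x hx y hy j hj he hjj
          simp [t10, t12] at hjj
          by_cases hj' : mid ≤ j
          · have hw : min (distTo pt S x) (distTo pt S y) ≤ distTo pt S z := by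
              rw [← he, hz]; exact mono _ _ hj' hj
            refine le_trans ?_ lift
            rw [min_eq_right (not_lt.1 hcmp), minSep_cons_cons]
            refine le_min (le_trans (le_min ?_ ?_) hw) ((min_le_right _ _).trans (min_le_right _ _))
            · exact (min_le_left _ _).trans (min_le_right _ _)
            · exact (min_le_right _ _).trans (min_le_left _ _)
          · exact (ic x hx y hy j hj he (by omega)).trans r1
  · refine ⟨hs.congr (by simp [searchInit]) rfl rfl hs.best, ?_, rfl, le_rfl, ?_, ?_, ?_⟩
    · rw [← hS]; exact tupleOf_congr fun i _ =>
        Prog.LoopFree.run_var (by simp [searchInit]) (by simp [searchInit]; omega)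
    · simp [searchInit, hs.size]
    · simpa [searchInit, hs.size] using Nat.lt_pow_succ_log_self (by norm_num) n
    · intro x hx y hy j hj he hjj
      simp [searchInit, hs.size] at hjj
      omega

/-! ### The tables -/

/-- Fill array `1` with halves. -/
def halfTable : Prog :=
  .seq (.seq (.set 8 (.const 0)) (.set 9 (.const 0)))
    (.loop (.natLt (.var 8) (.add (.var 0) (.const 1)))
      (.seq (.put 1 (.var 8) (.var 9)) (.seq (.put 1 (.add (.var 8) (.const 1)) (.var 9))
        (.seq (.set 8 (.add (.var 8) (.const 2))) (.set 9 (.add (.var 9) (.const 1)))))))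

theorem halfTable_spec : ∃ C, ∀ (pt : ℕ → Plane) (s : Store) (n : ℕ), s.var 0 = n →
    Runs pt halfTable s ((n + 1) * C) fun s' => ∀ d ≤ n, s'.arr 1 d = d / 2 := by
  let b : Test := .natLt (.var 8) (.add (.var 0) (.const 1))
  let i : Prog := .seq (.set 8 (.const 0)) (.set 9 (.const 0))
  let p : Prog := .seq (.put 1 (.var 8) (.var 9))
    (.seq (.put 1 (.add (.var 8) (.const 1)) (.var 9))
      (.seq (.set 8 (.add (.var 8) (.const 2))) (.set 9 (.add (.var 9) (.const 1)))))
  refine ⟨i.flatCost + (1 + b.cost + p.flatCost) + (1 + b.cost), fun pt s n h0 => ?_⟩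
  have hloop := Runs.loop_fuel (pt := pt) (b := b) (p := p) (T := p.flatCost)
    (Inv := fun m s' => s'.var 0 = n ∧ n + 1 - s'.var 8 = m ∧ s'.var 8 = 2 * s'.var 9 ∧
      ∀ d < s'.var 8, s'.arr 1 d = d / 2) ?_ (n + 1) (i.run pt s) ?_
  · refine (Runs.seq_loopFree (p := i) (by simp [i]) hloop).mono ?_ ?_
    · ring_nf; omega
    · rintro s' ⟨⟨m, e0, -, -, e⟩, hb⟩
      simp only [b, Test.Holds, NatExpr.eval, not_lt, e0] at hb
      exact fun d hd => e d (by omega)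
  · rintro m s' ⟨e0, e1, e2, e3⟩ hb
    simp only [b, Test.Holds, NatExpr.eval, e0] at hb
    refine Runs.of_loopFree (by simp [p]) ⟨n + 1 - (s'.var 8 + 2), by omega, ?_⟩
    simp [p, e0]
    refine ⟨by omega, fun d hd => ?_⟩
    rcases lt_trichotomy d (s'.var 8 + 1) with h | rfl | h
    · rw [Function.update_of_ne (by omega)]
      rcases Nat.lt_succ_iff_lt_or_eq.1 h with h' | rfl
      · rw [Function.update_of_ne (by omega), e3 d h']
      · rw [Function.update_self]; omega
    · rw [Function.update_self]; omega
    · omega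
  · simp [i, h0]

def lexTest (e f : NatExpr) : Test :=
  .disj (.realLt (.coord 0 e) (.coord 0 f))
    (.conj (.neg (.realLt (.coord 0 f) (.coord 0 e))) (.realLt (.coord 1 e) (.coord 1 f)))

noncomputable def lexKey (pt : ℕ → Plane) (a : ℕ) : ℝ ×ₗ ℝ := toLex (pt a 0, pt a 1)

theorem lexKey_lt {pt : ℕ → Plane} {a b : ℕ} : lexKey pt a < lexKey pt b ↔ LexLT pt a b :=
  Prod.Lex.toLex_lt_toLex

theorem lexTest_compares (pt : ℕ → Plane) (σ : ℕ → ℕ) : Compares pt lexTest σ (lexKey pt) := by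
  intro s _ e f
  rw [lexKey_lt]
  simp only [lexTest, Test.holds_disj, Test.Holds, RealExpr.eval, LexLT, not_lt]
  constructor
  · rintro (h | ⟨h, h'⟩)
    · exact .inl h
    · exact h.lt_or_eq.imp_right fun h => ⟨h, h'⟩
  · rintro (h | ⟨h, h'⟩)
    · exact .inl h
    · exact .inr ⟨h.le, h'⟩

/-- Compare by decreasing distance from the current tuple. -/
def distTest (m : ℕ) (e f : NatExpr) : Test :=
  .minLt (RealExpr.distTo (tupleExpr m) f) (RealExpr.distTo (tupleExpr m) e)

theorem distTest_compares (pt : ℕ → Plane) (m : ℕ) (σ : ℕ → ℕ) : Compares pt (distTest m) σ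
    fun a => OrderDual.toDual (distTo pt (tupleOf m fun i => σ (30 + i)) a) := by
  intro s hs e f
  rw [distTest, Test.holds_minLt, RealExpr.minOf_distTo, RealExpr.minOf_distTo, eval_tupleExpr,
    OrderDual.toDual_lt_toDual, tupleOf_congr fun i _ => hs (30 + i) (by omega)]

theorem injOn_of_surjOn {X : ℕ → ℕ} {n : ℕ} (hX : ∀ x < n, X x < n)
    (hX' : ∀ v < n, ∃ x < n, X x = v) : ∀ x < n, ∀ y < n, X x = X y → x = y := by
  let f : Fin n → Fin n := fun x => ⟨X x, hX x x.2⟩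
  have hf : Function.Injective f := Finite.injective_iff_surjective.2 fun v => by
    obtain ⟨x, hx, e⟩ := hX' v v.2
    exact ⟨⟨x, hx⟩, Fin.ext e⟩
  intro x hx y hy h
  simpa using @hf ⟨x, hx⟩ ⟨y, hy⟩ (Fin.ext h)

/-! ### Loops over all tuples -/

/-- Run `p` for all values below variable `0` of the `m` variables from `30` on. -/
def nest (p : Prog) : ℕ → Prog
  | 0 => p
  | m + 1 => .seq (.set (30 + m) (.const 0)) (.loop (.natLt (.var (30 + m)) (.var 0))
      (.seq (nest p m) (.set (30 + m) (.add (.var (30 + m)) (.const 1)))))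

theorem nest_keepsVar {p : Prog} {m x : ℕ} (h : p.KeepsVar x) (hx : x < 30 ∨ 30 + m ≤ x) :
    (nest p m).KeepsVar x := by
  induction m with
  | zero => exact h
  | succ m ih =>
    have := ih (by omega)
    simp [nest, this]
    omega

theorem nest_spec {β : Type*} [Preorder β] {pt : ℕ → Plane} {p : Prog} {n B M : ℕ} (hB : 8 ≤ B)
    {I : Store → Prop} {val : Store → β} {H : (ℕ → ℕ) → β → Prop}
    (hI0 : ∀ s, I s → s.var 0 = n) (hI : ∀ s j v, I s → I (s.set (30 + j) v))
    (hval : ∀ s j v, val (s.set (30 + j) v) = val s)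
    (hH : ∀ f v v', H f v → v ≤ v' → H f v')
    (hkeep : ∀ x, 30 ≤ x → p.KeepsVar x)
    (hp : ∀ s, I s → (∀ j < M, s.var (30 + j) < n) → Runs pt p s B fun s' =>
      I s' ∧ val s ≤ val s' ∧ H (fun j => s.var (30 + j)) (val s')) (m : ℕ) (hm : m ≤ M)
    (s : Store) (hs : I s) (hsM : ∀ j, m ≤ j → j < M → s.var (30 + j) < n) :
    Runs pt (nest p m) s ((2 * (n + 1)) ^ m * B) fun s' => I s' ∧ val s ≤ val s' ∧
      ∀ f : ℕ → ℕ, (∀ j < m, f j < n) → (∀ j, m ≤ j → f j = s.var (30 + j)) → H f (val s') := by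
  induction m generalizing s with
  | zero =>
    refine (hp s hs fun j hj => hsM j (Nat.zero_le _) hj).mono (by simp) ?_
    rintro s' ⟨h1, h2, h3⟩
    refine ⟨h1, h2, fun f _ hf => ?_⟩
    rwa [show f = fun j => s.var (30 + j) from funext fun j => hf j (Nat.zero_le _)]
  | succ m ih =>
    have hloop := Runs.loop_fuel (pt := pt) (b := .natLt (.var (30 + m)) (.var 0))
      (p := .seq (nest p m) (.set (30 + m) (.add (.var (30 + m)) (.const 1))))
      (T := (2 * (n + 1)) ^ m * B +
        (Prog.set (30 + m) (.add (.var (30 + m)) (.const 1))).flatCost)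
      (Inv := fun l s' => I s' ∧ (∀ j, m + 1 ≤ j → s'.var (30 + j) = s.var (30 + j)) ∧
        s'.var (30 + m) + l = n ∧ val s ≤ val s' ∧
        ∀ f : ℕ → ℕ, (∀ j < m, f j < n) → f m < s'.var (30 + m) →
          (∀ j, m + 1 ≤ j → f j = s.var (30 + j)) → H f (val s'))
      ?_ n ((Prog.set (30 + m) (.const 0)).run pt s) ?_
    · refine (Runs.seq_loopFree (by simp) hloop).mono ?_ ?_
      · simp only [Prog.flatCost, NatExpr.cost, Test.cost]
        have h1 : B ≤ (2 * (n + 1)) ^ m * B := Nat.le_mul_of_pos_left _ (by positivity)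
        have h2 : (2 * (n + 1)) ^ (m + 1) * B = 2 * (n + 1) * ((2 * (n + 1)) ^ m * B) := by ring
        rw [h2]
        generalize (2 * (n + 1)) ^ m * B = D at *
        have : n * 8 ≤ n * D := Nat.mul_le_mul_left _ (by omega)
        ring_nf at this ⊢
        omega
      · rintro s' ⟨⟨l, e0, e1, e2, e3, e4⟩, hb⟩
        simp only [Test.Holds, NatExpr.eval, not_lt, hI0 s' e0] at hb
        exact ⟨e0, e3, fun f hf hf' => e4 f (fun j hj => hf j (by omega))
          ((hf m (by omega)).trans_le hb) hf'⟩
    · rintro l s' ⟨i0, i1, i2, i3, i4⟩ hb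
      simp only [Test.Holds, NatExpr.eval, hI0 s' i0] at hb
      refine Runs.seq ((ih (by omega) s' i0 fun j hj hjM => ?_).frame.mono le_rfl ?_)
      · rcases hj.eq_or_lt with rfl | hj
        · exact hb
        · rw [i1 j hj]
          exact hsM j hj hjM
      · rintro s₁ ⟨⟨k0, k1, k2⟩, k3, -⟩
        have k4 : ∀ j, m ≤ j → s₁.var (30 + j) = s'.var (30 + j) := fun j hj =>
          k3 _ (nest_keepsVar (hkeep _ (by omega)) (by omega))
        refine Runs.of_loopFree (by simp) ⟨l - 1, by omega, hI _ _ _ k0, fun j hj => ?_, ?_, ?_,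
          fun f hf hfm hf' => ?_⟩
        · simp only [Prog.run, Store.set_var]
          rw [if_neg (by omega), k4 j (by omega), i1 j hj]
        · simp [k4 m le_rfl]
          omega
        · simp only [Prog.run, hval]
          exact i3.trans k1
        · simp only [Prog.run, hval, Store.set_var, if_true, NatExpr.eval, k4 m le_rfl] at hfm ⊢
          rcases Nat.lt_succ_iff_lt_or_eq.1 hfm with h | h
          · exact hH _ _ _ (i4 f hf h hf') k1
          · refine k2 f hf fun j hj => ?_
            rcases hj.eq_or_lt with rfl | hj
            · exact h
            · rw [hf' j hj, i1 j hj]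
    · refine ⟨hI _ _ _ hs, fun j hj => ?_, by simp, by simp [hval], fun f _ hf => ?_⟩
      · simp
        omega
      · simp at hf

/-! ### The algorithm -/

/-- Find the best extension of the current tuple. -/
def extend (m : ℕ) : Prog := .seq (mergeSort (distTest m) 3) (search m)

theorem extend_spec (m : ℕ) : ∃ C, ∀ (pt : ℕ → Plane) (n : ℕ) (s : Store),
    Ready pt n m s → (∀ a < n, ∀ b < n, pt a = pt b → a = b) →
    (∀ j < m, s.var (30 + j) < n) →
    Runs pt (extend m) s ((n + 1) * (Nat.log 2 n + 2) * C) fun s' =>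
      Ready pt n m s' ∧ bestSep pt m s ≤ bestSep pt m s' ∧ ∀ a < n, ∀ b < n,
        minSep pt (a :: b :: tupleOf m fun j => s.var (30 + j)) ≤ bestSep pt m s' := by
  obtain ⟨C₁, h₁⟩ := mergeSort_spec (WithTop ℝ)ᵒᵈ (distTest m) (a := 3) (by simp)
  obtain ⟨C₂, h₂⟩ := search_spec m
  refine ⟨C₁ + C₂, fun pt n s hs hpt hS => ?_⟩
  rw [Nat.mul_add]
  refine Runs.seq ((h₁ pt s.var _ (distTest_compares pt m s.var) s n hs.size
    fun _ _ => rfl).frame.mono le_rfl ?_)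
  rintro s₁ ⟨⟨e1, e2, e3⟩, f1, f2⟩
  have kv : ∀ x, 8 ≤ x ∨ x = 0 → s₁.var x = s.var x := fun x hx => f1 x (mergeSort_keepsVar hx)
  have ka : ∀ a, a ≠ 4 → a ≠ 3 → s₁.arr a = s.arr a := fun a h h' =>
    f2 a (mergeSort_keepsArr h h')
  have hR : Ready pt n m s₁ := hs.congr (kv 0 (by simp)) (ka 1 (by simp) (by simp))
    (ka 2 (by simp) (by simp)) (by rw [ka 0 (by simp) (by simp)]; exact hs.best)
  have hb : bestSep pt m s₁ = bestSep pt m s := by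
    unfold bestSep; rw [ka 0 (by simp) (by simp)]
  rw [← hb]
  refine h₂ pt n _ s₁ hR hpt (tupleOf_congr fun i _ => kv _ (by omega)) ?_ e1 e2 e3
  intro a ha
  obtain ⟨j, hj, rfl⟩ := List.mem_map.1 ha
  exact hS j (List.mem_range.1 hj)

/-- The algorithm for the `m + 2`-dispersion problem. -/
def dispersion (m : ℕ) : Prog :=
  .seq halfTable (.seq (mergeSort lexTest 2) (nest (extend m) m))

theorem extend_keepsVar {m x : ℕ} (hx : 30 ≤ x) : (extend m).KeepsVar x :=
  ⟨mergeSort_keepsVar (by omega), search_keepsVar (by omega)⟩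

theorem dispersion_spec (m : ℕ) : ∃ C, ∀ (pt : ℕ → Plane) (n : ℕ), 0 < n →
    (∀ a < n, ∀ b < n, pt a = pt b → a = b) →
    Runs pt (dispersion m) (Store.init n)
      ((2 * (n + 1)) ^ (m + 1) * (Nat.log 2 n + 2) * C) fun s =>
      (∀ i < m + 2, s.arr 0 i < n) ∧ ∀ f : ℕ → ℕ, (∀ i < m + 2, f i < n) →
        minSep pt (tupleOf (m + 2) f) ≤ minSep pt (tupleOf (m + 2) (s.arr 0)) := by
  obtain ⟨C₁, h₁⟩ := halfTable_spec
  obtain ⟨C₂, h₂⟩ := mergeSort_spec (ℝ ×ₗ ℝ) lexTest (a := 2) (by simp)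
  obtain ⟨C₃, h₃⟩ := extend_spec m
  refine ⟨C₁ + C₂ + (C₃ + 8), fun pt n hn hpt => ?_⟩
  have hT : (n + 1) * C₁ + ((n + 1) * (Nat.log 2 n + 2) * C₂ +
      (2 * (n + 1)) ^ m * ((n + 1) * (Nat.log 2 n + 2) * (C₃ + 8))) ≤
      (2 * (n + 1)) ^ (m + 1) * (Nat.log 2 n + 2) * (C₁ + C₂ + (C₃ + 8)) := by
    generalize Nat.log 2 n = l
    have e : n + 1 ≤ (2 * (n + 1)) ^ (m + 1) := by
      rw [pow_succ]
      have := Nat.le_mul_of_pos_left (2 * (n + 1)) (show 0 < (2 * (n + 1)) ^ m by positivity)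
      omega
    have e1 : (n + 1) * C₁ ≤ (2 * (n + 1)) ^ (m + 1) * (l + 2) * C₁ :=
      Nat.mul_le_mul_right _ (e.trans (Nat.le_mul_of_pos_right _ (by omega)))
    have e2 : (n + 1) * (l + 2) * C₂ ≤ (2 * (n + 1)) ^ (m + 1) * (l + 2) * C₂ :=
      Nat.mul_le_mul_right _ (Nat.mul_le_mul_right _ e)
    have e3 : (2 * (n + 1)) ^ m * ((n + 1) * (l + 2) * (C₃ + 8)) ≤
        (2 * (n + 1)) ^ (m + 1) * (l + 2) * (C₃ + 8) := by
      rw [pow_succ, Nat.mul_assoc, Nat.mul_assoc, Nat.mul_assoc]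
      refine Nat.mul_le_mul_left _ ?_
      refine Nat.mul_le_mul_right _ (by omega)
    calc _ ≤ _ := Nat.add_le_add e1 (Nat.add_le_add e2 e3)
      _ = _ := by ring
  refine Runs.mono (Runs.seq ((h₁ pt (Store.init n) n rfl).frame.mono le_rfl ?_)) hT fun _ h => h
  rintro s₁ ⟨e1, f1, f2⟩
  have k0 : s₁.var 0 = n := f1 0 (by simp [halfTable])
  refine Runs.seq ((h₂ pt s₁.var _ (lexTest_compares pt s₁.var) s₁ n k0
    fun _ _ => rfl).frame.mono le_rfl ?_)
  rintro s₂ ⟨⟨g1, g2, g3⟩, g4, g5⟩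
  have a0 : s₂.arr 0 = fun _ => 0 :=
    (g5 0 (mergeSort_keepsArr (by simp) (by simp))).trans (f2 0 (by simp [halfTable]))
  have hR : Ready pt n m s₂ := by
    refine ⟨(g4 0 (mergeSort_keepsVar (by simp))).trans k0, ?_, fun x y hxy hy => ?_, g2, g3, ?_⟩
    · rw [g5 1 (mergeSort_keepsArr (by simp) (by simp))]
      exact e1
    · refine lexKey_lt.1 (lt_of_le_of_ne (g1 x y hxy hy) fun h => hxy.ne ?_)
      refine injOn_of_surjOn g2 g3 x (hxy.trans hy) y hy
        (hpt _ (g2 x (hxy.trans hy)) _ (g2 y hy) ?_)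
      have h' := toLex.injective h
      rw [Prod.mk.injEq] at h'
      ext i
      fin_cases i
      · exact h'.1
      · exact h'.2
    · intro a ha
      rw [a0] at ha
      obtain ⟨j, -, rfl⟩ := List.mem_map.1 ha
      exact hn
  refine (nest_spec (β := WithTop ℝ) (n := n) (M := m) (I := Ready pt n m)
    (B := (n + 1) * (Nat.log 2 n + 2) * (C₃ + 8))
    (val := bestSep pt m) (H := fun f v => ∀ a < n, ∀ b < n, minSep pt (a :: b :: tupleOf m f) ≤ v)
    ?_ (fun s hs => hs.size) (fun s j v hs => hs.congr (by simp; omega) rfl rfl hs.best)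
    (fun _ _ _ => rfl) (fun f v v' h hv a ha b hb => (h a ha b hb).trans hv)
    (fun x hx => extend_keepsVar hx) (fun s hs hS => (h₃ pt n s hs hpt hS).mono ?_ fun _ h => h)
    m le_rfl s₂ hR fun j hj hj' => by omega).mono le_rfl ?_
  · calc 8 ≤ 1 * 1 * (C₃ + 8) := by omega
      _ ≤ _ := by gcongr <;> omega
  · exact Nat.mul_le_mul_left _ (by omega)
  · rintro s₃ ⟨hR₃, -, h⟩
    constructor
    · intro i hi
      exact hR₃.best _ (List.mem_map.2 ⟨i, List.mem_range.2 hi, rfl⟩)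
    · intro f hf
      have key := h (fun j => if j < m then f (j + 2) else s₂.var (30 + j))
        (fun j hj => by simp [hj, hf (j + 2) (by omega)])
        (fun j hj => by simp [hj.not_gt]) (f 0) (hf 0 (by omega)) (f 1) (hf 1 (by omega))
      have e : f 0 :: f 1 :: tupleOf m (fun j => if j < m then f (j + 2) else s₂.var (30 + j)) =
          tupleOf (m + 2) f := by
        rw [tupleOf_congr (g := fun j => f (j + 2)) fun i hi => if_pos hi]
        simp [tupleOf, List.range_succ_eq_map, Function.comp_def]
      rw [e] at key
      exact key

/-! ### Optimality and the running time -/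

theorem List.forall_mem_pairs {α : Type*} {R : α → α → Prop} {l : List α} :
    (∀ r ∈ l.pairs, R r.1 r.2) ↔ l.Pairwise R := by
  induction l with
  | nil => simp [List.pairs]
  | cons a l ih =>
    rw [List.pairwise_cons, ← ih, List.pairs]
    simp only [List.mem_append, List.mem_map]
    constructor
    · intro h
      exact ⟨fun b hb => h (a, b) (.inl ⟨b, hb, rfl⟩), fun r hr => h r (.inr hr)⟩
    · rintro ⟨h, h'⟩ r (⟨b, hb, rfl⟩ | hr)
      · exact h b hb
      · exact h' r hr

theorem coe_le_minSep_tupleOf {pt : ℕ → Plane} {r : ℝ} {k : ℕ} {f : ℕ → ℕ} :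
    (r : WithTop ℝ) ≤ minSep pt (tupleOf k f) ↔
      ∀ i j, i < j → j < k → r ≤ sqDist pt (f i) (f j) := by
  have h := List.forall_mem_pairs (R := fun a b => r ≤ sqDist pt a b) (l := tupleOf k f)
  rw [minSep, coe_le_minOf]
  simp only [List.mem_map, forall_exists_index, and_imp, forall_apply_eq_imp_iff₂]
  rw [h, List.pairwise_iff_getElem]
  simp only [tupleOf, List.length_map, List.length_range, List.getElem_map, List.getElem_range]
  exact ⟨fun h i j hij hj => h i j (hij.trans hj) hj hij, fun h i j _ hj hij => h i j hij hj⟩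

theorem sq_dist_eq_sqDist (pt : ℕ → Plane) (a b : ℕ) : dist (pt a) (pt b) ^ 2 = sqDist pt a b := by
  rw [EuclideanSpace.dist_eq, Real.sq_sqrt (Finset.sum_nonneg fun _ _ => sq_nonneg _),
    Fin.sum_univ_two, Real.dist_eq, Real.dist_eq, sq_abs, sq_abs, sqDist]
  ring

theorem isDispersionOutput_of_forall_minSep_le {n : ℕ} (p : Fin n ↪ Plane) {k : ℕ} (hk : 2 ≤ k)
    (hkn : k ≤ n) {s : Store} (hs : ∀ i < k, s.arr 0 i < n)
    (h : ∀ f : ℕ → ℕ, (∀ i < k, f i < n) →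
      minSep (inputPoints p) (tupleOf k f) ≤ minSep (inputPoints p) (tupleOf k (s.arr 0))) :
    IsDispersionOutput p k s := by
  have hpt : ∀ a (ha : a < n), inputPoints p a = p ⟨a, ha⟩ := fun a ha => dif_pos ha
  have bound : ∀ L : Finset Plane, L ⊆ Finset.univ.map p → L.card = k →
      ∀ i j, i < j → j < k →
        (L : Set Plane).infsep ^ 2 ≤ sqDist (inputPoints p) (s.arr 0 i) (s.arr 0 j) := by
    intro L hL hLk
    let e : Fin k ≃ L := (L.equivFinOfCardEq hLk).symm
    have hidx : ∀ i : Fin k, ∃ a : Fin n, p a = e i := by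
      intro i
      simpa using hL (e i).2
    choose g hg using hidx
    let f : ℕ → ℕ := fun i => if hi : i < k then g ⟨i, hi⟩ else 0
    have hf : ∀ i (hi : i < k), f i = g ⟨i, hi⟩ := fun i hi => dif_pos hi
    rw [← coe_le_minSep_tupleOf]
    refine le_trans (coe_le_minSep_tupleOf.2 fun i j hij hj => ?_)
      (h f fun i hi => by rw [hf i hi]; exact (g _).2)
    have hi : i < k := hij.trans hj
    rw [← sq_dist_eq_sqDist, hf i hi, hf j hj, hpt _ (g _).2, hpt _ (g _).2]
    simp only [Fin.eta, hg]
    refine pow_le_pow_left₀ Set.infsep_nonneg ?_ 2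
    refine Set.infsep_le_dist_of_mem (e _).2 (e _).2 fun he => hij.ne ?_
    simpa using e.injective (Subtype.ext he)
  have hinj : ∀ i j, i < j → j < k → s.arr 0 i ≠ s.arr 0 j := by
    obtain ⟨L, hL, hLk⟩ := Finset.exists_subset_card_eq (s := Finset.univ.map p) (n := k)
      (by simpa using hkn)
    intro i j hij hj e
    have h1 := bound L hL hLk i j hij hj
    have h2 : 0 < (L : Set Plane).infsep := by
      rw [Set.Finite.infsep_pos_iff_nontrivial L.finite_toSet, Finset.nontrivial_coe, ← Finset.one_lt_card_iff_nontrivial]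
      omega
    rw [e] at h1
    have h3 : sqDist (inputPoints p) (s.arr 0 j) (s.arr 0 j) = 0 := by simp [sqDist]
    have := pow_pos h2 2
    linarith
  let q : Fin k ↪ Fin n := ⟨fun i => ⟨s.arr 0 i, hs i i.2⟩, fun i j hij => by
    simp only [Fin.mk.injEq] at hij
    rcases lt_trichotomy i j with h | h | h
    · exact absurd hij (hinj i j h j.2)
    · exact h
    · exact absurd hij.symm (hinj j i h i.2)⟩
  refine ⟨q, fun j => rfl, ?_, by simp, fun L hL hLk => ?_⟩
  · intro x hx
    obtain ⟨i, -, rfl⟩ := Finset.mem_map.1 hx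
    exact Finset.mem_map_of_mem p (Finset.mem_univ (q i))
  · refine Set.Nontrivial.le_infsep ?_ ?_
    · rw [Finset.nontrivial_coe, ← Finset.one_lt_card_iff_nontrivial]
      simp
      omega
    · intro x hx y hy hxy
      obtain ⟨i, -, rfl⟩ := Finset.mem_map.1 hx
      obtain ⟨j, -, rfl⟩ := Finset.mem_map.1 hy
      have main : ∀ i j : Fin k, i < j →
          (L : Set Plane).infsep ≤ dist ((q.trans p) i) ((q.trans p) j) := by
        intro i j hij
        have h1 := bound L hL hLk i j hij j.2
        rw [← sq_dist_eq_sqDist, hpt _ (hs i i.2), hpt _ (hs j j.2)] at h1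
        exact (pow_le_pow_iff_left₀ Set.infsep_nonneg dist_nonneg two_ne_zero).1 h1
      rcases lt_trichotomy i j with h | rfl | h
      · exact main i j h
      · exact absurd rfl hxy
      · rw [dist_comm]
        exact main j i h

theorem theorem1 (k : ℕ) (hk : 2 ≤ k) :
    ∃ (A : Prog) (C : ℝ), ∀ (n : ℕ) (p : Fin n ↪ Plane), k ≤ n →
      ∃ (t : ℕ) (s : Store), Exec (inputPoints p) A (Store.init n) t s ∧
        IsDispersionOutput p k s ∧
        (t : ℝ) ≤ C * (n : ℝ) ^ (k - 1) * Real.logb 2 (n : ℝ) := by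
  obtain ⟨m, rfl⟩ : ∃ m, k = m + 2 := ⟨k - 2, by omega⟩
  obtain ⟨C, hC⟩ := dispersion_spec m
  refine ⟨dispersion m, 4 ^ (m + 1) * 3 * C, fun n p hn => ?_⟩
  obtain ⟨t, s, e, ht, hs, hopt⟩ := hC (inputPoints p) n (by omega) fun a ha b hb hab => by
    simp only [inputPoints, dif_pos ha, dif_pos hb] at hab
    simpa using p.injective hab
  refine ⟨t, s, e, isDispersionOutput_of_forall_minSep_le p hk hn hs hopt, ?_⟩
  have hlog : 1 ≤ Real.logb 2 (n : ℝ) := by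
    rw [Real.le_logb_iff_rpow_le (by norm_num) (by exact_mod_cast (by omega : 0 < n)),
      Real.rpow_one]
    exact_mod_cast (by omega : 2 ≤ n)
  have hnat : (Nat.log 2 n : ℝ) ≤ Real.logb 2 (n : ℝ) := by
    exact_mod_cast Real.natLog_le_logb n 2
  have hn1 : (1 : ℝ) ≤ n := by exact_mod_cast (by omega : 1 ≤ n)
  calc (t : ℝ) ≤ (((2 * (n + 1)) ^ (m + 1) * (Nat.log 2 n + 2) * C : ℕ) : ℝ) := by
        exact_mod_cast ht
    _ = (2 * ((n : ℝ) + 1)) ^ (m + 1) * (Nat.log 2 n + 2) * C := by push_cast; ring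
    _ ≤ (4 * (n : ℝ)) ^ (m + 1) * (3 * Real.logb 2 (n : ℝ)) * C := by
        have h4 : 2 * ((n : ℝ) + 1) ≤ 4 * n := by linarith
        have h3 : (Nat.log 2 n : ℝ) + 2 ≤ 3 * Real.logb 2 (n : ℝ) := by linarith
        exact mul_le_mul_of_nonneg_right (mul_le_mul (pow_le_pow_left₀ (by positivity) h4 _) h3
          (by positivity) (by positivity)) (by positivity)
    _ = _ := by
        rw [mul_pow, show m + 2 - 1 = m + 1 by omega]
        ring
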